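/- Let $m,n\ge 1$ be integers. For $\vec y=(y_1,\dots,y_m)\in(\mathbb R^n)^m$ write $|\vec y|=|y_1|+\cdots+|y_m|$ and, if $\vec y\neq 0$, $\vec y\,'=\vec y/|\vec y|$. Let $\Omega$ be a (real- or complex-valued) function on $(\mathbb R^n)^m$ such that (i) $\Omega(\lambda\vec y)=\Omega(\vec y)$ for all $\lambda>0$ and all $\vec y\in(\mathbb R^n)^m$; (ii) there are $0<\alpha<1$ and $A>0$ with $|\Omega(\xi)-\Omega(\eta)|\le A\,|\xi'-\eta'|^{\alpha}$ for all nonzero $\xi,\eta\in(\mathbb R^n)^m$; (iii) for each $j=1,\dots,m$ and all fixed $y_i\in\mathbb R^n$ $(i\ne j)$, $\int_{S^{n-1}}\Omega(y_1,\dots,y_m)\,d\sigma(y_j)=0$, where $\sigma$ is the surface measure of the unit sphere $S^{n-1}$. For functions $\vec f=(f_1,\dots,f_m)$ on $\mathbb R^n$ put, with $B(0,t)=\{y\in\mathbb R^n:|y|\le t\}$, $$F_t(\vec f)(x)=\frac1{t^m}\int_{B(0,t)^m}\frac{\Omega(\vec y)}{|\vec y|^{m(n-1)}}\prod_{i=1}^m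 f_i(x-y_i)\,d\vec y,\qquad \mu(\vec f)(x)=\Big(\int_0^\infty|F_t(\vec f)(x)|^2\,\frac{dt}{t}\Big)^{1/2}\in[0,\infty].$$ Suppose that for some $1<q_1,\dots,q_m<\infty$ and $q$ with $1/q=1/q_1+\cdots+1/q_m$ the operator $\mu$ is bounded from $L^{q_1}(\mathbb R^n)\times\cdots\times L^{q_m}(\mathbb R^n)$ to $L^q(\mathbb R^n)$, that is, $\|\mu(\vec f)\|_{L^q}\le C_0\prod_{i=1}^m\|f_i\|_{L^{q_i}}$ for some finite constant $C_0$ and all $f_i\in L^{q_i}(\mathbb R^n)$. For locally integrable $f$ let $\|f\|_{\mathrm{BMO}}=\sup_B\frac1{|B|}\int_B|f(x)-f_B|\,dx$, where the supremum is over all balls $B\subset\mathbb R^n$ and $f_B=\frac1{|B|}\int_B f$; $f\in\mathrm{BMO}(\mathbb R^n)$ means that $f$ is locally integrable and $\|f\|_{\mathrm{BMO}}<\infty$. Then there is a constant $C>0$ such that for all $f_1,\dots,f_m\in\mathrm{BMO}(\mathbb R^n)$: if $\mu(\vec f)(x_0)<\infty$ for some point $x_0\in\mathbb R^n$, then $\mu(\vec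 f)(x)<\infty$ for almost every $x\in\mathbb R^n$, $\mu(\vec f)\in\mathrm{BMO}(\mathbb R^n)$, and $$\|\mu(\vec f)\|_{\mathrm{BMO}}\le C\prod_{i=1}^m\|f_i\|_{\mathrm{BMO}}.$$ In particular $C$ does not depend on $\vec f$. -/

import Mathlib

open MeasureTheory Metric Set
open scoped ENNReal NNReal

/-- `|y| = |y_1| + ⋯ + |y_m|` for `y = (y_1, …, y_m) ∈ (ℝⁿ)^m`. -/
noncomputable def sumNorm {n m : ℕ} (y : Fin m → EuclideanSpace ℝ (Fin n)) : ℝ :=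
  ∑ i, ‖y i‖

/-- `y' = y / (|y_1| + ⋯ + |y_m|)`. -/
noncomputable def normalized {n m : ℕ} (y : Fin m → EuclideanSpace ℝ (Fin n)) :
    Fin m → EuclideanSpace ℝ (Fin n) :=
  (sumNorm y)⁻¹ • y

/-- Homogeneity of degree `0`: `Ω(λ y) = Ω(y)` for `λ > 0`. -/
def IsHomogeneousZero {n m : ℕ} {𝕜 : Type*}
    (Ω : (Fin m → EuclideanSpace ℝ (Fin n)) → 𝕜) : Prop :=
  ∀ (c : ℝ) (y : Fin m → EuclideanSpace ℝ (Fin n)), 0 < c → Ω (c • y) = Ω y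

/-- The Lipschitz condition: for some `0 < α < 1` and `C > 0`,
`|Ω(ξ) - Ω(η)| ≤ C |ξ' - η'|^α` for all nonzero `ξ, η ∈ (ℝⁿ)^m`. -/
def IsLipschitzKernel {n m : ℕ} {𝕜 : Type*} [RCLike 𝕜]
    (Ω : (Fin m → EuclideanSpace ℝ (Fin n)) → 𝕜) : Prop :=
  ∃ α C : ℝ, 0 < α ∧ α < 1 ∧ 0 < C ∧
    ∀ ξ η : Fin m → EuclideanSpace ℝ (Fin n), ξ ≠ 0 → η ≠ 0 →
      ‖Ω ξ - Ω η‖ ≤ C * sumNorm (normalized ξ - normalized η) ^ α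

/-- The vanishing condition: for each `j` and all fixed `y_i ∈ ℝⁿ`, `i ≠ j`, the integral of
`Ω(y_1, …, y_m)` in `y_j` over the unit sphere of `ℝⁿ` (with surface measure) is zero. -/
def HasVanishingSphereIntegrals {n m : ℕ} {𝕜 : Type*} [RCLike 𝕜]
    (Ω : (Fin m → EuclideanSpace ℝ (Fin n)) → 𝕜) : Prop :=
  ∀ (j : Fin m) (y : Fin m → EuclideanSpace ℝ (Fin n)),
    ∫ θ : sphere (0 : EuclideanSpace ℝ (Fin n)) 1,
      Ω (Function.update y j (θ : EuclideanSpace ℝ (Fin n)))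
        ∂(volume : Measure (EuclideanSpace ℝ (Fin n))).toSphere = 0

/-- `F_t(f)(x) = t^{-m} ∫_{B(0,t)^m} Ω(y) |y|^{-m(n-1)} ∏ f_i(x - y_i) dy`. -/
noncomputable def marcinkiewiczF {n m : ℕ} {𝕜 : Type*} [RCLike 𝕜]
    (Ω : (Fin m → EuclideanSpace ℝ (Fin n)) → 𝕜)
    (f : Fin m → EuclideanSpace ℝ (Fin n) → 𝕜) (t : ℝ) (x : EuclideanSpace ℝ (Fin n)) : 𝕜 :=
  (t ^ m)⁻¹ •
    ∫ y in (univ.pi fun _ : Fin m => closedBall (0 : EuclideanSpace ℝ (Fin n)) t),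
      (sumNorm y ^ (m * (n - 1)))⁻¹ • (Ω y * ∏ i, f i (x - y i))

/-- The multilinear Marcinkiewicz integral `μ(f)(x) = (∫_0^∞ |F_t(f)(x)|² dt/t)^{1/2}`,
with values in `[0, ∞]`. -/
noncomputable def marcinkiewicz {n m : ℕ} {𝕜 : Type*} [RCLike 𝕜]
    (Ω : (Fin m → EuclideanSpace ℝ (Fin n)) → 𝕜)
    (f : Fin m → EuclideanSpace ℝ (Fin n) → 𝕜) (x : EuclideanSpace ℝ (Fin n)) : ℝ≥0∞ :=
  (∫⁻ t in Ioi (0 : ℝ), ‖marcinkiewiczF Ω f t x‖ₑ ^ 2 / ENNReal.ofReal t) ^ (1 / 2 : ℝ)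

/-- `μ` is bounded from `L^{q_1} × ⋯ × L^{q_m}` to `L^q` (`eLpNorm` is the usual quasi-norm
when `q < 1`). -/
def MarcinkiewiczBounded {n m : ℕ} {𝕜 : Type*} [RCLike 𝕜]
    (Ω : (Fin m → EuclideanSpace ℝ (Fin n)) → 𝕜) (q : Fin m → ℝ) (q₀ : ℝ) : Prop :=
  ∃ C : ℝ≥0, ∀ f : Fin m → EuclideanSpace ℝ (Fin n) → 𝕜,
    (∀ i, MemLp (f i) (ENNReal.ofReal (q i)) volume) →
      eLpNorm (marcinkiewicz Ω f) (ENNReal.ofReal q₀) volume ≤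
        C * ∏ i, eLpNorm (f i) (ENNReal.ofReal (q i)) volume

/-- The BMO seminorm: the supremum over all balls `B` of the mean over `B` of `|f - f_B|`. -/
noncomputable def bmoNorm {n : ℕ} {F : Type*} [NormedAddCommGroup F] [NormedSpace ℝ F]
    (f : EuclideanSpace ℝ (Fin n) → F) : ℝ≥0∞ :=
  ⨆ (c : EuclideanSpace ℝ (Fin n)) (r : ℝ) (_ : 0 < r),
    ⨍⁻ x in closedBall c r, ‖f x - ⨍ z in closedBall c r, f z ∂volume‖ₑ ∂volume

/-- `f ∈ BMO(ℝⁿ)`: `f` is locally integrable with finite BMO seminorm. -/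
def MemBMO {n : ℕ} {F : Type*} [NormedAddCommGroup F] [NormedSpace ℝ F]
    (f : EuclideanSpace ℝ (Fin n) → F) : Prop :=
  LocallyIntegrable f volume ∧ bmoNorm f < ∞

/-! ### Volumes of balls -/

/-! Fix a ball `B` of centre `c` and radius `r`, and let `B*` be the concentric ball of radius `8
r`. The vanishing sphere integrals, together with homogeneity, make `F_t` blind to constants in each
argument (`marcinkiewiczF_sub_const`), so every `f_i` may be replaced by `f_i - (f_i)_{B*}`. The
integral over `(ℝⁿ)^m` is then cut into two pieces only, `(B*)^m` and its complement; tuples with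
some entries near and others far need no separate treatment. As `μ(f)(x)` is the `L²(dt/t)` norm of
`t ↦ F_t(f)(x)`, it differs from the norm of the far piece by at most `μ` of the near piece.

Near piece: John–Nirenberg puts `f_i - (f_i)_{B*}` in `L^{q_i}(B*)`, and the assumed boundedness
gives an `L^q` norm of at most a constant times `∏ ‖f_i‖_{BMO} |B*|^{1/q}`
(`eLpNorm_marcinkiewicz_nearPart_le`). Far piece: it is almost constant on `B`. By Minkowski's
inequality and the regularity of the truncated kernel in `L²(dt/t)`
(`TruncatedKernelRegular.eLpNorm_sub_le`), its variation is an integral against `D^{-mn} (r/D)^β`,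
where `D` is the distance to the diagonal point `(c, …, c)`; the sum over dyadic shells converges
since the mean oscillation grows only linearly with the number of doublings
(`lintegral_compl_closedBall_le`, `farSquare_le_add`).

Since `q` may be less than `1`, the near piece cannot simply be averaged over `B`. Chebyshev's
inequality still shows that, off a small fixed proportion of `B`, `μ(f)` is within a multiple of `∏
‖f_i‖_{BMO}` of a number depending on `B`. The John–Strömberg inequality (`volume_superlevel_le`,
`lintegral_rpow_sub_le`) turns this into local integrability and a BMO bound. The same inequality
yields John–Nirenberg for the `f_i`.

Finiteness spreads from `x₀` as follows. For balls centred at `x₀` the near piece has finite `μ` at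
`x₀` itself (`marcinkiewicz_nearPart_center_lt_top`), hence the far piece is finite there and so on
the whole ball, while the near piece is finite almost everywhere. -/

theorem volume_closedBall_scale {n : ℕ} (x y : EuclideanSpace ℝ (Fin n)) {s r : ℝ} (hs : 0 ≤ s)
    (hr : 0 ≤ r) :
    volume (closedBall x (s * r)) = ENNReal.ofReal s ^ n * volume (closedBall y r) := by
  rw [Measure.addHaar_closedBall _ _ (mul_nonneg hs hr), Measure.addHaar_closedBall _ _ hr,
    ← mul_assoc, mul_pow, ENNReal.ofReal_mul (by positivity), ENNReal.ofReal_pow hs,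
    finrank_euclideanSpace_fin]

theorem volume_closedBall_ne_zero {n : ℕ} (x : EuclideanSpace ℝ (Fin n)) {r : ℝ} (hr : 0 < r) :
    volume (closedBall x r) ≠ 0 :=
  (measure_closedBall_pos _ _ hr).ne'

theorem volume_closedBall_ne_top {n : ℕ} (x : EuclideanSpace ℝ (Fin n)) (r : ℝ) :
    volume (closedBall x r) ≠ ∞ :=
  measure_closedBall_lt_top.ne

/-! ### The John–Strömberg inequality -/

/-- The admissible proportion of exceptional points in the John–Strömberg inequality. -/
noncomputable def exceptionalRatio (n : ℕ) : ℝ≥0∞ := (4 * 12 ^ n)⁻¹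

theorem exceptionalRatio_ne_zero (n : ℕ) : exceptionalRatio n ≠ 0 := by
  simp [exceptionalRatio, ENNReal.mul_eq_top]

theorem exceptionalRatio_ne_top (n : ℕ) : exceptionalRatio n ≠ ∞ := by
  simp [exceptionalRatio]

theorem exceptionalRatio_le (n : ℕ) : exceptionalRatio n ≤ 4⁻¹ := by
  apply ENNReal.inv_le_inv.2
  calc (4 : ℝ≥0∞) = 4 * 1 := by simp
    _ ≤ 4 * 12 ^ n := by gcongr; exact one_le_pow₀ (by norm_num)

/-- The base is `12 = 6 · 2`: a factor `6` from the Vitali enlargement and a factor `2` from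
doubling the ball in `volume_superlevel_step`. -/
theorem twelve_pow_mul_exceptionalRatio (n : ℕ) : 12 ^ n * exceptionalRatio n = 4⁻¹ := by
  have h0 : (12 : ℝ≥0∞) ^ n ≠ 0 := by simp
  have h1 : (12 : ℝ≥0∞) ^ n ≠ ∞ := by simp
  rw [exceptionalRatio, ENNReal.mul_inv (by simp) (by simp), mul_comm, mul_assoc,
    ENNReal.inv_mul_cancel h0 h1, mul_one]

theorem two_pow_mul_exceptionalRatio_le (n : ℕ) : 2 ^ n * exceptionalRatio n ≤ 4⁻¹ := by
  rw [← twelve_pow_mul_exceptionalRatio n]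
  gcongr
  norm_num

/-- The two exceptional sets cannot cover `B`; at a remaining point `g` is within `l` of both
constants. -/
theorem norm_sub_le_of_volume_lt {X F : Type*} [MeasurableSpace X] [NormedAddCommGroup F]
    {μ : Measure X} {g : X → F} {B : Set X} {a b : F} {l : ℝ}
    (h : μ {y ∈ B | l < ‖g y - a‖} + μ {y ∈ B | l < ‖g y - b‖} < μ B) : ‖a - b‖ ≤ 2 * l := by
  obtain ⟨y, hyB, hy⟩ : ∃ y ∈ B, y ∉ {y ∈ B | l < ‖g y - a‖} ∪ {y ∈ B | l < ‖g y - b‖} := by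
    by_contra! hc
    exact (((measure_mono hc).trans (measure_union_le _ _)).trans_lt h).false
  simp only [mem_union, mem_ofPred_eq, hyB, true_and, not_or, not_lt] at hy
  calc ‖a - b‖ = ‖(g y - b) - (g y - a)‖ := by congr 1; abel
    _ ≤ ‖g y - b‖ + ‖g y - a‖ := norm_sub_le _ _
    _ ≤ 2 * l := by linarith [hy.1, hy.2]

/-- Stopping-time selection: around almost every point of a set `U` which is thin in a ball of
radius `r`, there is a first scale at which `U` has density more than `1/2`. -/
theorem ae_exists_stopping_radius {n : ℕ} (U : Set (EuclideanSpace ℝ (Fin n))) {r : ℝ}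
    (hr : 0 < r) :
    ∀ᵐ x ∂(volume.restrict U), volume (U ∩ closedBall x r) ≤ 2⁻¹ * volume (closedBall x r) →
      ∃ ρ : ℝ, 0 < ρ ∧ 6 * ρ ≤ r ∧
        2⁻¹ * volume (closedBall x ρ) < volume (U ∩ closedBall x ρ) ∧
        volume (U ∩ closedBall x (6 * ρ)) ≤ 2⁻¹ * volume (closedBall x (6 * ρ)) := by
  filter_upwards [IsUnifLocDoublingMeasure.ae_tendsto_measure_inter_div
    (volume : Measure (EuclideanSpace ℝ (Fin n))) U 1] with x hx h0
  have hlim : Filter.Tendsto (fun j : ℕ => (6 : ℝ)⁻¹ ^ j * r) Filter.atTop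
      (nhdsWithin 0 (Ioi 0)) := by
    rw [tendsto_nhdsWithin_iff]
    refine ⟨?_, Filter.Eventually.of_forall fun j => by simp only [mem_Ioi]; positivity⟩
    have := (tendsto_pow_atTop_nhds_zero_of_lt_one (r := (6 : ℝ)⁻¹) (by norm_num)
      (by norm_num)).mul_const r
    simpa using this
  have h1 := hx (fun _ => x) _ hlim (Filter.Eventually.of_forall fun j =>
    mem_closedBall_self (by positivity))
  have h2 : ∃ j : ℕ, 2⁻¹ * volume (closedBall x ((6 : ℝ)⁻¹ ^ j * r)) <
      volume (U ∩ closedBall x ((6 : ℝ)⁻¹ ^ j * r)) := by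
    have := (h1.eventually (lt_mem_nhds (show (2⁻¹ : ℝ≥0∞) < 1 by
      rw [ENNReal.inv_lt_one]; norm_num))).exists
    obtain ⟨j, hj⟩ := this
    refine ⟨j, ?_⟩
    rwa [ENNReal.lt_div_iff_mul_lt (.inl (volume_closedBall_ne_zero _ (by positivity)))
      (.inl (volume_closedBall_ne_top _ _))] at hj
  classical
  have hs := Nat.find_spec h2
  have hm := fun k => Nat.find_min h2 (m := k)
  set j := Nat.find h2
  -- Index zero is excluded by thinness at radius `r`; for a later index the preceding scale, six
  -- times larger, has density at most `1/2`.
  rcases j with _ | k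
  · simp only [pow_zero, one_mul] at hs
    exact absurd hs (not_lt.2 h0)
  · have e : 6 * ((6 : ℝ)⁻¹ ^ (k + 1) * r) = (6 : ℝ)⁻¹ ^ k * r := by
      rw [pow_succ]; ring
    refine ⟨_, by positivity, ?_, hs, ?_⟩
    · rw [e]
      exact mul_le_of_le_one_left hr.le (pow_le_one₀ (by norm_num) (by norm_num))
    · rw [e]
      exact not_lt.1 (hm k (Nat.lt_succ_self k))

/-- One step of the exponential decay. Around points of `S` take stopping balls for `U`. At radius
`6 ρ` the set `U` has density at most `1/2`, so the constant of that ball is within `2 l` of the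
constant of the doubled ball, and the inductive bound `δ` applies on it. At radius `ρ` the density
exceeds `1/2`, so the disjoint Vitali balls have total volume at most `2 |U|`, which is a small
proportion of the original ball. -/
theorem volume_superlevel_step {n : ℕ} {F : Type*} [NormedAddCommGroup F]
    {g : EuclideanSpace ℝ (Fin n) → F} {a : EuclideanSpace ℝ (Fin n) → ℝ → F} {l : ℝ} (hl : 0 < l)
    (h : ∀ x r, 0 < r → volume {y ∈ closedBall x r | l < ‖g y - a x r‖} ≤
      exceptionalRatio n * volume (closedBall x r)) {s : ℝ} (hs : 0 ≤ s) {δ : ℝ≥0∞}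
    (hδ : ∀ x r, 0 < r → volume {y ∈ closedBall x r | s < ‖g y - a x r‖} ≤
      δ * volume (closedBall x r)) (x : EuclideanSpace ℝ (Fin n)) {r : ℝ} (hr : 0 < r) :
    volume {y ∈ closedBall x r | s + 4 * l < ‖g y - a x r‖} ≤
      2⁻¹ * δ * volume (closedBall x r) := by
  have hr2 : 0 < 2 * r := by positivity
  have hpos : ∀ (y : EuclideanSpace ℝ (Fin n)) {t : ℝ}, 0 < t → volume (closedBall y t) ≠ 0 :=
    fun y t ht => volume_closedBall_ne_zero y ht
  have hfin : ∀ (y : EuclideanSpace ℝ (Fin n)) (t : ℝ), volume (closedBall y t) ≠ ∞ :=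
    fun y t => volume_closedBall_ne_top y t
  set U := {y ∈ closedBall x (2 * r) | l < ‖g y - a x (2 * r)‖} with hU
  have hUvol : volume U ≤ 2 ^ n * exceptionalRatio n * volume (closedBall x r) := by
    refine (h x (2 * r) hr2).trans_eq ?_
    rw [volume_closedBall_scale x x (by norm_num) hr.le]
    simp only [ENNReal.ofReal_ofNat]
    ring
  have hlt : ∀ (y : EuclideanSpace ℝ (Fin n)) {t : ℝ}, 0 < t → ∀ {c d : ℝ≥0∞}, c + d < 1 →
      c * volume (closedBall y t) + d * volume (closedBall y t) < volume (closedBall y t) := by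
    intro y t ht c d hcd
    rw [← add_mul]
    calc (c + d) * volume (closedBall y t) < 1 * volume (closedBall y t) :=
          (ENNReal.mul_lt_mul_iff_left (hpos y ht) (hfin y t)).2 hcd
      _ = _ := one_mul _
  have q44 : (4⁻¹ : ℝ≥0∞) + 4⁻¹ < 1 := by
    rw [← ENNReal.toReal_lt_toReal (by simp) (by simp), ENNReal.toReal_add (by simp) (by simp)]
    norm_num
  have q42 : (4⁻¹ : ℝ≥0∞) + 2⁻¹ < 1 := by
    rw [← ENNReal.toReal_lt_toReal (by simp) (by simp), ENNReal.toReal_add (by simp) (by simp)]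
    norm_num
  have hcmp : ‖a x r - a x (2 * r)‖ ≤ 2 * l := by
    refine norm_sub_le_of_volume_lt (μ := volume) (g := g) (B := closedBall x r) ?_
    refine lt_of_le_of_lt (add_le_add (h x r hr) (d := volume U) ?_)
      (lt_of_le_of_lt ?_ (hlt x hr q44))
    · exact measure_mono fun y hy => ⟨closedBall_subset_closedBall (by linarith) hy.1, hy.2⟩
    · gcongr
      · exact exceptionalRatio_le n
      · exact hUvol.trans (by gcongr; exact two_pow_mul_exceptionalRatio_le n)
  set S := {y ∈ closedBall x r | s + 4 * l < ‖g y - a x r‖} with hS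
  have hSs : ∀ y ∈ S, s + 2 * l < ‖g y - a x (2 * r)‖ := by
    intro y hy
    have : ‖g y - a x r‖ ≤ ‖g y - a x (2 * r)‖ + ‖a x r - a x (2 * r)‖ := by
      calc ‖g y - a x r‖ = ‖(g y - a x (2 * r)) - (a x r - a x (2 * r))‖ := by congr 1; abel
        _ ≤ _ := norm_sub_le _ _
    linarith [hy.2]
  have hSU : S ⊆ U := fun y hy =>
    ⟨closedBall_subset_closedBall (by linarith) hy.1, by linarith [hSs y hy]⟩
  have hradius := (ae_exists_stopping_radius U hr)
  have hradius_S : ∀ᵐ y ∂(volume.restrict S), _ := ae_mono (Measure.restrict_mono hSU le_rfl) hradius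
  let P : EuclideanSpace ℝ (Fin n) → ℝ → Prop := fun y ρ => 0 < ρ ∧ 6 * ρ ≤ r ∧
        2⁻¹ * volume (closedBall y ρ) < volume (U ∩ closedBall y ρ) ∧
        volume (U ∩ closedBall y (6 * ρ)) ≤ 2⁻¹ * volume (closedBall y (6 * ρ))
  let G := {y ∈ S | ∃ ρ, P y ρ}
  have hG : volume S ≤ volume G := by
    have hSG : volume (S \ G) = 0 := by
      have h3 : ∀ᵐ y ∂(volume.restrict S), y ∉ S \ G := by
        filter_upwards [hradius_S] with y hy hyS
        refine hyS.2 ⟨hyS.1, hy ?_⟩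
        refine (measure_mono inter_subset_left).trans (hUvol.trans ?_)
        rw [← one_mul r, volume_closedBall_scale x y zero_le_one hr.le, one_mul]
        simp only [ENNReal.ofReal_one, one_pow, one_mul]
        gcongr
        exact (two_pow_mul_exceptionalRatio_le n).trans (ENNReal.inv_le_inv.2 (by norm_num))
      have h4 := ae_iff.1 h3
      simp only [not_not] at h4
      change volume.restrict S (S \ G) = 0 at h4
      exact le_antisymm ((measure_mono (show S \ G ⊆ (S \ G) ∩ S from fun y hy => ⟨hy, hy.1⟩)).trans
        ((Measure.le_restrict_apply S (S \ G)).trans h4.le)) zero_le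
    calc volume S ≤ volume (G ∪ S \ G) := measure_mono fun y hy => by
          by_cases hyG : y ∈ G
          · exact .inl hyG
          · exact .inr ⟨hy, hyG⟩
      _ ≤ volume G + volume (S \ G) := measure_union_le _ _
      _ = volume G := by rw [hSG, add_zero]
  have hch : ∀ y : EuclideanSpace ℝ (Fin n), ∃ ρ, y ∈ G → P y ρ := fun y => by
    by_cases hy : y ∈ G
    · exact ⟨hy.2.choose, fun _ => hy.2.choose_spec⟩
    · exact ⟨0, fun h => absurd h hy⟩
  choose ρ hρ using hch
  obtain ⟨v, hvG, hdisj, hcov⟩ := Vitali.exists_disjoint_subfamily_covering_enlargement_closedBall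
    G id ρ r (fun y hy => by have := hρ y hy; have := this.1; have := (hρ y hy).2.1; linarith) 6
    (by norm_num)
  simp only [id] at hdisj hcov
  have hvc : v.Countable := by
    refine hdisj.countable_of_nonempty_interior fun y hy => ?_
    exact ⟨y, ball_subset_interior_closedBall (mem_ball_self (hρ y (hvG hy)).1)⟩
  have : Countable v := hvc.to_subtype
  have hball : ∀ y ∈ v, volume (S ∩ closedBall y (6 * ρ y)) ≤
      δ * 6 ^ n * 2 * volume (U ∩ closedBall y (ρ y)) := by
    intro y hy
    have hp := hρ y (hvG hy)
    have h6 : 0 < 6 * ρ y := by linarith [hp.1]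
    have hyr : closedBall y (6 * ρ y) ⊆ closedBall x (2 * r) := by
      refine closedBall_subset_closedBall' ?_
      have := mem_closedBall.1 (hvG hy).1.1
      linarith [hp.2.1]
    -- The exceptional sets fill at most `1/4` and `1/2` of the ball. The second bound is the
    -- stopping rule, usable since `6 ρ ≤ r` keeps this ball inside the doubled one.
    have hc : ‖a y (6 * ρ y) - a x (2 * r)‖ ≤ 2 * l := by
      refine norm_sub_le_of_volume_lt (μ := volume) (g := g) (B := closedBall y (6 * ρ y)) ?_
      refine lt_of_le_of_lt (add_le_add (h y _ h6)
        (d := volume (U ∩ closedBall y (6 * ρ y))) ?_)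
        (lt_of_le_of_lt ?_ (hlt y h6 q42))
      · exact measure_mono fun z hz => ⟨⟨hyr hz.1, hz.2⟩, hz.1⟩
      · gcongr
        · exact exceptionalRatio_le n
        · exact hp.2.2.2
    calc volume (S ∩ closedBall y (6 * ρ y))
        ≤ volume {z ∈ closedBall y (6 * ρ y) | s < ‖g z - a y (6 * ρ y)‖} := by
          refine measure_mono fun z hz => ⟨hz.2, ?_⟩
          have : ‖g z - a x (2 * r)‖ ≤
              ‖g z - a y (6 * ρ y)‖ + ‖a y (6 * ρ y) - a x (2 * r)‖ := by
            calc ‖g z - a x (2 * r)‖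
                = ‖(g z - a y (6 * ρ y)) + (a y (6 * ρ y) - a x (2 * r))‖ := by congr 1; abel
              _ ≤ _ := norm_add_le _ _
          linarith [hSs z hz.1]
      _ ≤ δ * volume (closedBall y (6 * ρ y)) := hδ y _ h6
      _ = δ * 6 ^ n * volume (closedBall y (ρ y)) := by
          rw [volume_closedBall_scale y y (by norm_num) hp.1.le, mul_assoc]; simp
      _ = δ * 6 ^ n * 2 * (2⁻¹ * volume (closedBall y (ρ y))) := by
          rw [mul_assoc _ 2, ← mul_assoc 2, ENNReal.mul_inv_cancel (by simp) (by simp), one_mul]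
      _ ≤ _ := by gcongr; exact hp.2.2.1.le
  have hcovG : G ⊆ ⋃ y : v, S ∩ closedBall (y : EuclideanSpace ℝ (Fin n)) (6 * ρ y) := by
    intro y hy
    obtain ⟨b, hb, hsub⟩ := hcov y hy
    exact mem_iUnion.2 ⟨⟨b, hb⟩, hy.1, hsub (mem_closedBall_self (hρ y hy).1.le)⟩
  calc volume S ≤ volume G := hG
    _ ≤ ∑' y : v, volume (S ∩ closedBall (y : EuclideanSpace ℝ (Fin n)) (6 * ρ y)) :=
        (measure_mono hcovG).trans (measure_iUnion_le _)
    _ ≤ ∑' y : v, δ * 6 ^ n * 2 * volume (U ∩ closedBall (y : EuclideanSpace ℝ (Fin n)) (ρ y)) :=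
        ENNReal.tsum_le_tsum fun y => hball y y.2
    -- Measurability of `g`, hence of `U`, is not assumed; measurability of the balls suffices for
    -- additivity of the restricted measure.
    _ = δ * 6 ^ n * 2 *
        ∑' y : v, volume.restrict U (closedBall (y : EuclideanSpace ℝ (Fin n)) (ρ y)) := by
        rw [ENNReal.tsum_mul_left]
        congr 2
        ext y
        rw [Measure.restrict_apply measurableSet_closedBall, inter_comm]
    _ ≤ δ * 6 ^ n * 2 * volume U := by
        gcongr
        have hd : Pairwise (Function.onFun Disjoint fun y : v =>
            closedBall (y : EuclideanSpace ℝ (Fin n)) (ρ y)) :=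
          fun y z hyz => hdisj y.2 z.2 fun h => hyz (Subtype.ext h)
        rw [← measure_iUnion hd fun _ => measurableSet_closedBall]
        exact (measure_mono (subset_univ _)).trans_eq (Measure.restrict_apply_univ U)
    _ ≤ δ * 6 ^ n * 2 * (2 ^ n * exceptionalRatio n * volume (closedBall x r)) := by gcongr
    _ = δ * 2 * ((6 * 2) ^ n * exceptionalRatio n) * volume (closedBall x r) := by
        rw [mul_pow]; ring
    _ = 2⁻¹ * δ * volume (closedBall x r) := by
        have : (2 : ℝ≥0∞) * 4⁻¹ = 2⁻¹ := by
          rw [← ENNReal.toReal_eq_toReal_iff' (by finiteness) (by simp), ENNReal.toReal_mul]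
          norm_num
        rw [show (6 : ℝ≥0∞) * 2 = 12 by norm_num, twelve_pow_mul_exceptionalRatio, mul_assoc δ,
          this, mul_comm δ]

/-- **John–Strömberg inequality**: if on every ball `g` is within `l` of a constant off a small
proportion of the ball, the level sets of the deviation decay exponentially. -/
theorem volume_superlevel_le {n : ℕ} {F : Type*} [NormedAddCommGroup F]
    {g : EuclideanSpace ℝ (Fin n) → F} {a : EuclideanSpace ℝ (Fin n) → ℝ → F} {l : ℝ} (hl : 0 < l)
    (h : ∀ x r, 0 < r → volume {y ∈ closedBall x r | l < ‖g y - a x r‖} ≤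
      exceptionalRatio n * volume (closedBall x r)) (k : ℕ) :
    ∀ x r, 0 < r → volume {y ∈ closedBall x r | (4 * k + 1) * l < ‖g y - a x r‖} ≤
      2⁻¹ ^ k * volume (closedBall x r) := by
  induction k with
  | zero => exact fun x r _ => by simpa using measure_mono fun y hy => hy.1
  | succ k ih =>
    intro x r hr
    have := volume_superlevel_step hl h (by positivity) ih x hr
    rw [pow_succ']
    convert this using 5
    push_cast
    ring_nf

/-- The constant in the `L^p` form of the John–Strömberg inequality. -/
noncomputable def oscillationConst (p : ℝ) : ℝ≥0∞ :=
  1 + ∑' k : ℕ, ENNReal.ofReal (4 * k + 5) ^ p * 2⁻¹ ^ k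

theorem oscillationConst_lt_top {p : ℝ} (hp : 0 ≤ p) : oscillationConst p < ∞ := by
  refine ENNReal.add_lt_top.2 ⟨by simp, ?_⟩
  set N := ⌈p⌉₊
  have hsum : Summable fun k : ℕ => (2 * 5 ^ N) * (((k + 1 : ℕ) : ℝ) ^ N * (2⁻¹ : ℝ) ^ (k + 1)) :=
    ((summable_nat_add_iff 1).2 (summable_pow_mul_geometric_of_norm_lt_one N
      (r := (2⁻¹ : ℝ)) (by norm_num))).mul_left _
  refine lt_of_le_of_lt (ENNReal.tsum_le_tsum fun k => ?_) hsum.tsum_ofReal_lt_top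
  rw [ENNReal.ofReal_rpow_of_nonneg (by positivity) hp,
    show (2⁻¹ : ℝ≥0∞) = ENNReal.ofReal 2⁻¹ by
      rw [ENNReal.ofReal_inv_of_pos (by norm_num)]; simp,
    ← ENNReal.ofReal_pow (by norm_num), ← ENNReal.ofReal_mul (by positivity)]
  refine ENNReal.ofReal_le_ofReal ?_
  calc (4 * (k : ℝ) + 5) ^ p * 2⁻¹ ^ k ≤ (5 * ((k : ℝ) + 1)) ^ N * 2⁻¹ ^ k := by
        gcongr
        rw [← Real.rpow_natCast]
        calc (4 * (k : ℝ) + 5) ^ p ≤ (4 * (k : ℝ) + 5) ^ (N : ℝ) :=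
              Real.rpow_le_rpow_of_exponent_le (by linarith [k.cast_nonneg (α := ℝ)])
                (Nat.le_ceil p)
          _ ≤ _ := Real.rpow_le_rpow (by positivity)
              (by linarith [k.cast_nonneg (α := ℝ)]) (by positivity)
    _ = _ := by rw [mul_pow, pow_succ]; push_cast; ring

/-- Cut the range of the deviation into layers of thickness `4 l` and sum the geometric decay of
`volume_superlevel_le`. It serves with `p = q i` for the arguments and with `p = 1` for `μ(f)`. -/
theorem lintegral_rpow_sub_le {n : ℕ} {F : Type*} [NormedAddCommGroup F]
    {g : EuclideanSpace ℝ (Fin n) → F} (hg : AEStronglyMeasurable g volume)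
    {a : EuclideanSpace ℝ (Fin n) → ℝ → F} {l : ℝ} (hl : 0 < l)
    (h : ∀ x r, 0 < r → volume {y ∈ closedBall x r | l < ‖g y - a x r‖} ≤
      exceptionalRatio n * volume (closedBall x r)) {p : ℝ} (hp : 0 < p)
    (x : EuclideanSpace ℝ (Fin n)) {r : ℝ} (hr : 0 < r) :
    ∫⁻ y in closedBall x r, ‖g y - a x r‖ₑ ^ p ≤
      oscillationConst p * ENNReal.ofReal l ^ p * volume (closedBall x r) := by
  let A : ℕ → Set (EuclideanSpace ℝ (Fin n)) := fun k => {y | (4 * k + 1) * l < ‖g y - a x r‖}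
  have hA : ∀ k, NullMeasurableSet (A k) (volume.restrict (closedBall x r)) := fun k =>
    nullMeasurableSet_lt aemeasurable_const
      (hg.restrict.sub aestronglyMeasurable_const).norm.aemeasurable
  have hpt : ∀ y, ‖g y - a x r‖ₑ ^ p ≤ ENNReal.ofReal l ^ p +
      ∑' k, (A k).indicator (fun _ => (ENNReal.ofReal (4 * k + 5) * ENNReal.ofReal l) ^ p) y := by
    intro y
    rw [← ofReal_norm]
    set d := ‖g y - a x r‖
    by_cases hd : d ≤ l
    · refine le_add_right ?_
      gcongr
    · push Not at hd
      refine le_add_left ?_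
      have h1 : 1 < d / l := (one_lt_div hl).2 hd
      -- With `K = k + 1` this is the layer `(4k + 1) l < d ≤ (4k + 5) l`.
      set K := ⌈(d / l - 1) / 4⌉₊ with hK
      have hK0 : 0 < K := Nat.ceil_pos.2 (by linarith)
      have hK1 : (d / l - 1) / 4 ≤ K := Nat.le_ceil _
      have hK2 : (K : ℝ) < (d / l - 1) / 4 + 1 := Nat.ceil_lt_add_one (by linarith)
      obtain ⟨k, hk⟩ : ∃ k, K = k + 1 := ⟨K - 1, by omega⟩
      rw [hk] at hK1 hK2
      push_cast at hK1 hK2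
      have e : d = d / l * l := by field_simp
      refine le_trans ?_ (ENNReal.le_tsum k)
      rw [indicator_of_mem]
      · gcongr
        rw [← ENNReal.ofReal_mul (by positivity)]
        refine ENNReal.ofReal_le_ofReal ?_
        rw [e]
        gcongr
        linarith
      · change (4 * (k : ℝ) + 1) * l < d
        rw [e]
        gcongr
        linarith
  calc ∫⁻ y in closedBall x r, ‖g y - a x r‖ₑ ^ p
      ≤ ∫⁻ y in closedBall x r, (ENNReal.ofReal l ^ p + ∑' k, (A k).indicator
          (fun _ => (ENNReal.ofReal (4 * k + 5) * ENNReal.ofReal l) ^ p) y) :=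
        lintegral_mono hpt
    _ = ENNReal.ofReal l ^ p * volume (closedBall x r) + ∑' k : ℕ,
          (ENNReal.ofReal (4 * k + 5) * ENNReal.ofReal l) ^ p *
            volume.restrict (closedBall x r) (A k) := by
        rw [lintegral_add_left measurable_const, lintegral_const, Measure.restrict_apply_univ,
          lintegral_tsum fun k => aemeasurable_const.indicator₀ (hA k)]
        congr 2
        ext k
        rw [lintegral_indicator_const₀ (hA k)]
    _ ≤ ENNReal.ofReal l ^ p * volume (closedBall x r) + ∑' k : ℕ,
          (ENNReal.ofReal (4 * k + 5) ^ p * 2⁻¹ ^ k) *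
            (ENNReal.ofReal l ^ p * volume (closedBall x r)) := by
        refine add_le_add le_rfl (ENNReal.tsum_le_tsum fun k => ?_)
        rw [ENNReal.mul_rpow_of_nonneg _ _ hp.le]
        calc _ ≤ ENNReal.ofReal (4 * k + 5) ^ p * ENNReal.ofReal l ^ p *
              (2⁻¹ ^ k * volume (closedBall x r)) := by
              gcongr
              refine le_trans ?_ (volume_superlevel_le hl h k x r hr)
              rw [Measure.restrict_apply₀ (hA k)]
              exact measure_mono fun y hy => ⟨hy.2, hy.1⟩
          _ = _ := by ring
    _ = _ := by rw [ENNReal.tsum_mul_right, oscillationConst]; ring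

/-! ### Functions of bounded mean oscillation -/

section BMO

variable {n : ℕ} {F : Type*} [NormedAddCommGroup F]

theorem integrableOn_closedBall {f : EuclideanSpace ℝ (Fin n) → F}
    (hf : LocallyIntegrable f volume) (c : EuclideanSpace ℝ (Fin n)) (r : ℝ) :
    IntegrableOn f (closedBall c r) volume :=
  hf.integrableOn_isCompact (isCompact_closedBall c r)

/-- Local integrability against the kernels `|x - z|^{-(n-1)}`, at every point `x`. -/
def RieszIntegrable (h : EuclideanSpace ℝ (Fin n) → F) : Prop :=
  ∀ (x : EuclideanSpace ℝ (Fin n)) (R : ℝ),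
    ∫⁻ z in closedBall x R, (‖x - z‖ₑ ^ (n - 1))⁻¹ * ‖h z‖ₑ < ∞

theorem tsum_linear_mul_geometric_lt_top {A B : ℝ≥0∞} (hA : A ≠ ∞) (hB : B ≠ ∞) :
    ∑' k : ℕ, (A + k * B) * 2⁻¹ ^ k < ∞ := by
  have h1 : ∑' k : ℕ, (2⁻¹ : ℝ≥0∞) ^ k < ∞ := by
    rw [ENNReal.tsum_geometric, ENNReal.one_sub_inv_two, inv_inv]; simp
  have h2 : ∑' k : ℕ, (k : ℝ≥0∞) * 2⁻¹ ^ k < ∞ := by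
    have hs := summable_pow_mul_geometric_of_norm_lt_one 1 (r := (2⁻¹ : ℝ)) (by norm_num)
    refine lt_of_eq_of_lt (tsum_congr fun k => ?_) hs.tsum_ofReal_lt_top
    rw [pow_one, ENNReal.ofReal_mul (by positivity), ENNReal.ofReal_natCast,
      ENNReal.ofReal_pow (by norm_num), ENNReal.ofReal_inv_of_pos (by norm_num),
      ENNReal.ofReal_ofNat]
  have e : ∀ k : ℕ, (A + k * B) * 2⁻¹ ^ k = A * 2⁻¹ ^ k + B * (k * 2⁻¹ ^ k) := fun k => by ring
  simp_rw [e]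
  rw [ENNReal.tsum_add, ENNReal.tsum_mul_left, ENNReal.tsum_mul_left]
  exact ENNReal.add_lt_top.2 ⟨ENNReal.mul_lt_top hA.lt_top h1, ENNReal.mul_lt_top hB.lt_top h2⟩

/-- On the shell `2^{-(k+1)} R < |z - x| ≤ 2^{-k} R` the kernel times the volume of the ball is of
order `2^{-k} R`, which beats means growing linearly in `k`. -/
theorem lintegral_riesz_lt_top (hn : 1 ≤ n) {h : EuclideanSpace ℝ (Fin n) → F}
    (hm : AEStronglyMeasurable h volume)
    {A B : ℝ≥0∞} (hA : A ≠ ∞) (hB : B ≠ ∞) (x : EuclideanSpace ℝ (Fin n)) {R : ℝ} (hR : 0 < R)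
    (hh : ∀ k : ℕ, ∫⁻ z in closedBall x (2⁻¹ ^ k * R), ‖h z‖ₑ ≤
      (A + k * B) * volume (closedBall x (2⁻¹ ^ k * R))) :
    ∫⁻ z in closedBall x R, (‖x - z‖ₑ ^ (n - 1))⁻¹ * ‖h z‖ₑ < ∞ := by
  have : Nonempty (Fin n) := ⟨⟨0, hn⟩⟩
  let w : ℕ → ℝ := fun k => 2⁻¹ ^ k * R
  have hw : ∀ k, 0 < w k := fun k => by positivity
  let wt : ℕ → ℝ≥0∞ := fun k => (ENNReal.ofReal (w (k + 1)) ^ (n - 1))⁻¹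
  have hae : ∀ᵐ z ∂(volume : Measure (EuclideanSpace ℝ (Fin n))), z ≠ x :=
    Measure.ae_ne volume x
  have hpt : ∀ᵐ z ∂(volume.restrict (closedBall x R)), (‖x - z‖ₑ ^ (n - 1))⁻¹ * ‖h z‖ₑ ≤
      ∑' k, (closedBall x (w k)).indicator (fun z => wt k * ‖h z‖ₑ) z := by
    filter_upwards [ae_restrict_of_ae hae, ae_restrict_mem measurableSet_closedBall] with z hz hzR
    have hd : 0 < dist z x := dist_pos.2 hz
    have hex : ∃ k : ℕ, w (k + 1) < dist z x := by
      obtain ⟨k, hk⟩ := exists_pow_lt_of_lt_one (x := dist z x / R) (y := (2⁻¹ : ℝ))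
        (by positivity) (by norm_num)
      refine ⟨k, ?_⟩
      rw [lt_div_iff₀ hR] at hk
      refine lt_of_le_of_lt ?_ hk
      simp only [w, pow_succ]
      have : 0 < (2⁻¹ : ℝ) ^ k * R := by positivity
      linarith
    classical
    have hk1 := Nat.find_spec hex
    have hk2 := fun j => Nat.find_min hex (m := j)
    set k := Nat.find hex
    have hmem : z ∈ closedBall x (w k) := by
      rcases hk0 : k with _ | j
      · simpa [w] using hzR
      · rw [hk0] at hk2
        exact not_lt.1 (hk2 j (Nat.lt_succ_self j))
    refine le_trans ?_ (ENNReal.le_tsum k)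
    rw [indicator_of_mem hmem]
    simp only [wt]
    gcongr
    rw [← ofReal_norm, ← dist_eq_norm, dist_comm]
    exact ENNReal.ofReal_le_ofReal hk1.le
  have hterm : ∀ k : ℕ, wt k * ((A + k * B) * volume (closedBall x (w k))) =
      (2 ^ (n - 1) * ENNReal.ofReal R * volume (closedBall x 1)) * ((A + k * B) * 2⁻¹ ^ k) := by
    intro k
    have e1 : ENNReal.ofReal (w k) = 2⁻¹ ^ k * ENNReal.ofReal R := by
      rw [ENNReal.ofReal_mul (by positivity), ENNReal.ofReal_pow (by norm_num),
        ENNReal.ofReal_inv_of_pos (by norm_num), ENNReal.ofReal_ofNat]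
    have e2 : ENNReal.ofReal (w (k + 1)) = 2⁻¹ * ENNReal.ofReal (w k) := by
      rw [← ENNReal.ofReal_ofNat 2, ← ENNReal.ofReal_inv_of_pos (by norm_num),
        ← ENNReal.ofReal_mul (by norm_num)]
      simp only [w, pow_succ]
      ring_nf
    have e3 : volume (closedBall x (w k)) = ENNReal.ofReal (w k) ^ n * volume (closedBall x 1) := by
      rw [← volume_closedBall_scale x x (hw k).le zero_le_one, mul_one]
    have hne0 : ENNReal.ofReal (w k) ≠ 0 := by simpa using hw k
    obtain ⟨N, rfl⟩ : ∃ N, n = N + 1 := ⟨n - 1, by omega⟩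
    simp only [wt]
    rw [e3, e2, Nat.add_sub_cancel, mul_pow, ENNReal.mul_inv (by simp) (by simp),
      ← ENNReal.inv_pow, inv_inv, pow_succ (ENNReal.ofReal (w k)) N]
    calc _ = (ENNReal.ofReal (w k) ^ N)⁻¹ * ENNReal.ofReal (w k) ^ N * ENNReal.ofReal (w k) *
          (2 ^ N * ((A + k * B) * volume (closedBall x 1))) := by ring
      _ = _ := by
        rw [ENNReal.inv_mul_cancel (pow_ne_zero _ hne0) (by simp), one_mul, e1]
        ring
  calc _ ≤ ∫⁻ z in closedBall x R, ∑' k,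
          (closedBall x (w k)).indicator (fun z => wt k * ‖h z‖ₑ) z := lintegral_mono_ae hpt
    _ ≤ ∑' k, ∫⁻ z, (closedBall x (w k)).indicator (fun z => wt k * ‖h z‖ₑ) z := by
        rw [← lintegral_tsum fun k =>
          ((hm.enorm.const_mul _).indicator measurableSet_closedBall)]
        exact setLIntegral_le_lintegral _ _
    _ ≤ ∑' k, wt k * ((A + k * B) * volume (closedBall x (w k))) := by
        refine ENNReal.tsum_le_tsum fun k => ?_
        rw [lintegral_indicator measurableSet_closedBall, lintegral_const_mul']
        · gcongr
          exact hh k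
        · simp only [wt]
          have : 0 < w (k + 1) := hw _
          simp [this]
    _ < ∞ := by
        simp_rw [hterm]
        rw [ENNReal.tsum_mul_left]
        refine ENNReal.mul_lt_top ?_ (tsum_linear_mul_geometric_lt_top hA hB)
        have := volume_closedBall_ne_top x 1
        finiteness

theorem RieszIntegrable.const (hn : 1 ≤ n) (a : F) :
    RieszIntegrable (fun _ : EuclideanSpace ℝ (Fin n) => a) := by
  intro x R
  refine lt_of_le_of_lt (lintegral_mono_set (closedBall_subset_closedBall (le_max_left R 1))) ?_
  refine lintegral_riesz_lt_top hn aestronglyMeasurable_const (A := ‖a‖ₑ) (B := 0) (by simp) (by simp) x (by positivity)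
    fun k => ?_
  rw [setLIntegral_const]
  simp

theorem RieszIntegrable.sub_const {f : EuclideanSpace ℝ (Fin n) → F} (hn : 1 ≤ n)
    (hf : RieszIntegrable f) (a : F) : RieszIntegrable (fun z => f z - a) := by
  intro x R
  calc ∫⁻ z in closedBall x R, (‖x - z‖ₑ ^ (n - 1))⁻¹ * ‖f z - a‖ₑ
      ≤ ∫⁻ z in closedBall x R, ((‖x - z‖ₑ ^ (n - 1))⁻¹ * ‖f z‖ₑ +
          (‖x - z‖ₑ ^ (n - 1))⁻¹ * ‖a‖ₑ) := by
        refine lintegral_mono fun z => ?_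
        rw [← mul_add]
        gcongr
        exact enorm_sub_le
    _ = _ := lintegral_add_right _ (by fun_prop)
    _ < ∞ := ENNReal.add_lt_top.2 ⟨hf x R, RieszIntegrable.const hn a x R⟩

variable [NormedSpace ℝ F]

/-- The average of `f` over the closed ball of centre `c` and radius `r`. -/
noncomputable def ballAverage (f : EuclideanSpace ℝ (Fin n) → F) (c : EuclideanSpace ℝ (Fin n))
    (r : ℝ) : F :=
  ⨍ z in closedBall c r, f z ∂volume

theorem lintegral_sub_ballAverage_le {f : EuclideanSpace ℝ (Fin n) → F} {b : ℝ≥0∞}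
    (h : bmoNorm f ≤ b) (c : EuclideanSpace ℝ (Fin n)) {r : ℝ} (hr : 0 < r) :
    ∫⁻ x in closedBall c r, ‖f x - ballAverage f c r‖ₑ ≤ b * volume (closedBall c r) := by
  have h1 : ⨍⁻ x in closedBall c r, ‖f x - ballAverage f c r‖ₑ ∂volume ≤ b :=
    (le_iSup₂_of_le (f := fun c r => ⨆ (_ : 0 < r), ⨍⁻ x in closedBall c r,
      ‖f x - ⨍ z in closedBall c r, f z ∂volume‖ₑ ∂volume) c r
      (le_iSup_of_le hr le_rfl)).trans h
  rwa [setLAverage_eq, ENNReal.div_le_iff (volume_closedBall_ne_zero c hr)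
    (volume_closedBall_ne_top c r)] at h1

theorem enorm_ballAverage_sub_mul_le [CompleteSpace F] {f : EuclideanSpace ℝ (Fin n) → F}
    (hf : LocallyIntegrable f volume) (a : F) (c : EuclideanSpace ℝ (Fin n)) (r : ℝ) :
    ‖ballAverage f c r - a‖ₑ * volume (closedBall c r) ≤
      ∫⁻ x in closedBall c r, ‖f x - a‖ₑ := by
  have hfin := volume_closedBall_ne_top c r
  have hi := integrableOn_closedBall hf c r
  have e : ∫ x in closedBall c r, (f x - a) =
      (volume (closedBall c r)).toReal • (ballAverage f c r - a) := by
    rw [integral_sub hi (integrableOn_const hfin), setIntegral_const, smul_sub, ballAverage,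
      ← measure_smul_setAverage f hfin]
    rfl
  calc _ = ‖∫ x in closedBall c r, (f x - a)‖ₑ := by
        rw [e, enorm_smul, mul_comm, Real.enorm_eq_ofReal ENNReal.toReal_nonneg,
          ENNReal.ofReal_toReal hfin]
    _ ≤ _ := enorm_integral_le_lintegral_enorm _

/-- The average over the ball is itself within `M` of any competing constant, which costs the factor
`2`. -/
theorem bmoNorm_le_two_mul [CompleteSpace F] {f : EuclideanSpace ℝ (Fin n) → F}
    (hf : LocallyIntegrable f volume) {M : ℝ≥0∞}
    (h : ∀ (c : EuclideanSpace ℝ (Fin n)) (r : ℝ), 0 < r →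
      ∃ a : F, ∫⁻ x in closedBall c r, ‖f x - a‖ₑ ≤ M * volume (closedBall c r)) :
    bmoNorm f ≤ 2 * M := by
  refine iSup₂_le fun c r => iSup_le fun hr => ?_
  have hpos := volume_closedBall_ne_zero c hr
  have hfin := volume_closedBall_ne_top c r
  obtain ⟨a, ha⟩ := h c r hr
  rw [setLAverage_eq, ENNReal.div_le_iff hpos hfin]
  have havg : ‖ballAverage f c r - a‖ₑ * volume (closedBall c r) ≤ M * volume (closedBall c r) :=
    (enorm_ballAverage_sub_mul_le hf a c r).trans ha
  calc ∫⁻ x in closedBall c r, ‖f x - ballAverage f c r‖ₑ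
      ≤ ∫⁻ x in closedBall c r, (‖f x - a‖ₑ + ‖ballAverage f c r - a‖ₑ) := by
        refine lintegral_mono fun x => ?_
        calc ‖f x - ballAverage f c r‖ₑ = ‖(f x - a) - (ballAverage f c r - a)‖ₑ := by
              congr 1; abel
          _ ≤ _ := enorm_sub_le
    _ = (∫⁻ x in closedBall c r, ‖f x - a‖ₑ) +
          ‖ballAverage f c r - a‖ₑ * volume (closedBall c r) := by
        rw [lintegral_add_right _ measurable_const, setLIntegral_const]
    _ ≤ M * volume (closedBall c r) + M * volume (closedBall c r) := add_le_add ha havg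
    _ = _ := by ring

theorem enorm_ballAverage_sub_double_le [CompleteSpace F] {f : EuclideanSpace ℝ (Fin n) → F}
    (hf : LocallyIntegrable f volume) {b : ℝ≥0∞} (h : bmoNorm f ≤ b)
    (c : EuclideanSpace ℝ (Fin n)) {r : ℝ} (hr : 0 < r) :
    ‖ballAverage f c r - ballAverage f c (2 * r)‖ₑ ≤ 2 ^ n * b := by
  rw [← ENNReal.mul_le_mul_iff_left (volume_closedBall_ne_zero c hr)
    (volume_closedBall_ne_top c r)]
  calc _ ≤ ∫⁻ x in closedBall c r, ‖f x - ballAverage f c (2 * r)‖ₑ :=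
        enorm_ballAverage_sub_mul_le hf _ c r
    _ ≤ ∫⁻ x in closedBall c (2 * r), ‖f x - ballAverage f c (2 * r)‖ₑ :=
        lintegral_mono_set (closedBall_subset_closedBall (by linarith))
    _ ≤ b * volume (closedBall c (2 * r)) := lintegral_sub_ballAverage_le h c (by positivity)
    _ = _ := by
        rw [volume_closedBall_scale c c (by norm_num) hr.le]
        simp only [ENNReal.ofReal_ofNat]
        ring

theorem enorm_ballAverage_sub_two_pow_le [CompleteSpace F] {f : EuclideanSpace ℝ (Fin n) → F}
    (hf : LocallyIntegrable f volume) {b : ℝ≥0∞} (h : bmoNorm f ≤ b)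
    (c : EuclideanSpace ℝ (Fin n)) {r : ℝ} (hr : 0 < r) (k : ℕ) :
    ‖ballAverage f c r - ballAverage f c (2 ^ k * r)‖ₑ ≤ k * (2 ^ n * b) := by
  induction k with
  | zero => simp
  | succ k ih =>
    have h1 := enorm_ballAverage_sub_double_le hf h c (r := 2 ^ k * r) (by positivity)
    rw [← mul_assoc, ← pow_succ'] at h1
    calc _ = ‖(ballAverage f c r - ballAverage f c (2 ^ k * r)) +
          (ballAverage f c (2 ^ k * r) - ballAverage f c (2 ^ (k + 1) * r))‖ₑ := by
            congr 1; abel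
      _ ≤ k * (2 ^ n * b) + 2 ^ n * b := (enorm_add_le _ _).trans (add_le_add ih h1)
      _ = _ := by push_cast; ring

theorem lintegral_sub_const_le {f : EuclideanSpace ℝ (Fin n) → F}
    {b : ℝ≥0∞} (h : bmoNorm f ≤ b) (c : EuclideanSpace ℝ (Fin n)) {r : ℝ} (hr : 0 < r) (a : F) :
    ∫⁻ x in closedBall c r, ‖f x - a‖ₑ ≤
      (b + ‖ballAverage f c r - a‖ₑ) * volume (closedBall c r) := by
  calc _ ≤ ∫⁻ x in closedBall c r, (‖f x - ballAverage f c r‖ₑ + ‖ballAverage f c r - a‖ₑ) := by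
        refine lintegral_mono fun x => ?_
        calc ‖f x - a‖ₑ = ‖(f x - ballAverage f c r) + (ballAverage f c r - a)‖ₑ := by
              congr 1; abel
          _ ≤ _ := enorm_add_le _ _
    _ ≤ _ := by
        rw [lintegral_add_right _ measurable_const, setLIntegral_const, add_mul]
        gcongr
        exact lintegral_sub_ballAverage_le h c hr

/-- The mean oscillation of a `BMO` function about its average over a ball grows linearly in the
number of doublings of that ball. -/
theorem lintegral_sub_ballAverage_two_pow_le [CompleteSpace F]
    {f : EuclideanSpace ℝ (Fin n) → F}
    (hf : LocallyIntegrable f volume) {b : ℝ≥0∞} (h : bmoNorm f ≤ b)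
    (c : EuclideanSpace ℝ (Fin n)) {r : ℝ} (hr : 0 < r) (k : ℕ) :
    ∫⁻ x in closedBall c (2 ^ k * r), ‖f x - ballAverage f c r‖ₑ ≤
      (1 + k * 2 ^ n) * b * volume (closedBall c (2 ^ k * r)) := by
  refine (lintegral_sub_const_le h c (by positivity) _).trans ?_
  gcongr
  rw [← enorm_neg, neg_sub]
  calc _ ≤ b + k * (2 ^ n * b) := by gcongr; exact enorm_ballAverage_sub_two_pow_le hf h c hr k
    _ = _ := by ring

/-- Each halving of the ball moves the average by at most `2 ^ n * b`, so the means of `|f|` over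
shrinking balls grow at most linearly. The conclusion holds at every point, not just almost
everywhere, because `F_t` has to converge absolutely at the prescribed `x₀`. -/
theorem RieszIntegrable.of_bmoNorm_le [CompleteSpace F] (hn : 1 ≤ n)
    {f : EuclideanSpace ℝ (Fin n) → F} (hf : LocallyIntegrable f volume) {b : ℝ≥0}
    (h : bmoNorm f ≤ b) : RieszIntegrable f := by
  intro x R
  refine lt_of_le_of_lt (lintegral_mono_set (closedBall_subset_closedBall (le_max_left R 1))) ?_
  set S := max R 1
  have hS : 0 < S := by positivity
  refine lintegral_riesz_lt_top hn hf.aestronglyMeasurable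
    (A := b + ‖ballAverage f x S‖ₑ) (B := 2 ^ n * b) (by finiteness) (by finiteness) x hS
    fun k => ?_
  have hk : 0 < 2⁻¹ ^ k * S := by positivity
  have e : (2 : ℝ) ^ k * (2⁻¹ ^ k * S) = S := by
    rw [← mul_assoc, ← mul_pow]; norm_num
  have h1 := enorm_ballAverage_sub_two_pow_le hf h x hk k
  rw [e] at h1
  have h2 := lintegral_sub_const_le h x hk 0
  simp only [sub_zero] at h2
  refine h2.trans (mul_le_mul_left ?_ _)
  calc (b : ℝ≥0∞) + ‖ballAverage f x (2⁻¹ ^ k * S)‖ₑ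
      = b + ‖(ballAverage f x (2⁻¹ ^ k * S) - ballAverage f x S) + ballAverage f x S‖ₑ := by
        congr 2; abel
    _ ≤ b + (k * (2 ^ n * b) + ‖ballAverage f x S‖ₑ) := by
        gcongr; exact (enorm_add_le _ _).trans (by gcongr)
    _ = _ := by ring

/-- **John–Nirenberg inequality** in `L^p` form. -/
theorem lintegral_rpow_sub_ballAverage_le
    {f : EuclideanSpace ℝ (Fin n) → F} (hf : LocallyIntegrable f volume) {b : ℝ≥0} (hb : 0 < b)
    (h : bmoNorm f ≤ b) {p : ℝ} (hp : 0 < p) (c : EuclideanSpace ℝ (Fin n)) {r : ℝ} (hr : 0 < r) :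
    ∫⁻ y in closedBall c r, ‖f y - ballAverage f c r‖ₑ ^ p ≤
      oscillationConst p * ((exceptionalRatio n)⁻¹ * b) ^ p * volume (closedBall c r) := by
  have hε0 := exceptionalRatio_ne_zero n
  have hε1 := exceptionalRatio_ne_top n
  have htop : (exceptionalRatio n)⁻¹ * b ≠ ∞ :=
    ENNReal.mul_ne_top (ENNReal.inv_ne_top.2 hε0) ENNReal.coe_ne_top
  have hne : (exceptionalRatio n)⁻¹ * b ≠ 0 := by simp [hε1, hb.ne']
  -- The level at which Chebyshev's inequality leaves exactly the admissible proportion; `b > 0`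
  -- makes it positive.
  set l := ((exceptionalRatio n)⁻¹ * b).toReal with hl
  have hl0 : 0 < l := ENNReal.toReal_pos hne htop
  have hle : ENNReal.ofReal l = (exceptionalRatio n)⁻¹ * b := ENNReal.ofReal_toReal htop
  rw [← hle]
  refine lintegral_rpow_sub_le hf.aestronglyMeasurable hl0 (fun x s hs => ?_) hp c hr
  have hm := mul_meas_ge_le_lintegral₀ (μ := volume.restrict (closedBall x s))
    (f := fun y => ‖f y - ballAverage f x s‖ₑ)
    (hf.aestronglyMeasurable.restrict.sub aestronglyMeasurable_const).enorm (ENNReal.ofReal l)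
  have h1 := hm.trans (lintegral_sub_ballAverage_le h x hs)
  have h2 : volume {y ∈ closedBall x s | l < ‖f y - ballAverage f x s‖} ≤
      volume.restrict (closedBall x s)
        {y | ENNReal.ofReal l ≤ ‖f y - ballAverage f x s‖ₑ} := by
    refine le_trans (measure_mono fun y hy => ?_) (Measure.le_restrict_apply _ _)
    refine ⟨?_, hy.1⟩
    rw [mem_ofPred_eq, ← ofReal_norm]
    exact ENNReal.ofReal_le_ofReal hy.2.le
  refine h2.trans ?_
  have hb0 : (b : ℝ≥0∞) ≠ 0 := by simpa using hb.ne'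
  rw [hle] at h1 ⊢
  rw [← ENNReal.mul_le_mul_iff_right hb0 ENNReal.coe_ne_top]
  calc _ = exceptionalRatio n * ((exceptionalRatio n)⁻¹ * b *
        volume.restrict (closedBall x s)
          {y | (exceptionalRatio n)⁻¹ * b ≤ ‖f y - ballAverage f x s‖ₑ}) := by
        rw [← mul_assoc, ← mul_assoc, ENNReal.mul_inv_cancel hε0 hε1, one_mul]
    _ ≤ exceptionalRatio n * (b * volume (closedBall x s)) := by gcongr
    _ = _ := by ring

end BMO

/-! ### The kernel -/

section SumNorm

variable {n m : ℕ}

theorem sumNorm_nonneg (u : Fin m → EuclideanSpace ℝ (Fin n)) : 0 ≤ sumNorm u :=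
  Finset.sum_nonneg fun _ _ => norm_nonneg _

theorem norm_apply_le_sumNorm (u : Fin m → EuclideanSpace ℝ (Fin n)) (i : Fin m) :
    ‖u i‖ ≤ sumNorm u :=
  Finset.single_le_sum (f := fun i => ‖u i‖) (fun _ _ => norm_nonneg _) (Finset.mem_univ i)

theorem norm_le_sumNorm (u : Fin m → EuclideanSpace ℝ (Fin n)) : ‖u‖ ≤ sumNorm u :=
  (pi_norm_le_iff_of_nonneg (sumNorm_nonneg u)).2 (norm_apply_le_sumNorm u)

theorem sumNorm_add_le (u v : Fin m → EuclideanSpace ℝ (Fin n)) :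
    sumNorm (u + v) ≤ sumNorm u + sumNorm v := by
  simp only [sumNorm, ← Finset.sum_add_distrib]
  exact Finset.sum_le_sum fun i _ => norm_add_le _ _

theorem sumNorm_smul (a : ℝ) (u : Fin m → EuclideanSpace ℝ (Fin n)) :
    sumNorm (a • u) = |a| * sumNorm u := by
  simp [sumNorm, norm_smul, Finset.mul_sum]

theorem sumNorm_pos {u : Fin m → EuclideanSpace ℝ (Fin n)} (hu : u ≠ 0) : 0 < sumNorm u :=
  (norm_pos_iff.2 hu).trans_le (norm_le_sumNorm u)

theorem abs_sumNorm_sub_le (u v : Fin m → EuclideanSpace ℝ (Fin n)) :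
    |sumNorm u - sumNorm v| ≤ sumNorm (u - v) := by
  simp only [sumNorm, ← Finset.sum_sub_distrib]
  exact (Finset.abs_sum_le_sum_abs _ _).trans
    (Finset.sum_le_sum fun i _ => abs_norm_sub_norm_le _ _)

theorem sumNorm_le_of_forall_le {u : Fin m → EuclideanSpace ℝ (Fin n)} {s : ℝ}
    (h : ∀ i, ‖u i‖ ≤ s) : sumNorm u ≤ m * s := by
  calc sumNorm u ≤ ∑ _i : Fin m, s := Finset.sum_le_sum fun i _ => h i
    _ = m * s := by simp

@[fun_prop]
theorem continuous_sumNorm :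
    Continuous (sumNorm : (Fin m → EuclideanSpace ℝ (Fin n)) → ℝ) := by
  unfold sumNorm
  fun_prop

/-- Write `u' - v' = (u - v) / |u| + (1 / |u| - 1 / |v|) v`; each term has size at most `|u - v| /
|u|`. -/
theorem sumNorm_normalized_sub_le {u v : Fin m → EuclideanSpace ℝ (Fin n)} (hu : u ≠ 0)
    (hv : v ≠ 0) : sumNorm (normalized u - normalized v) ≤ 2 * sumNorm (u - v) / sumNorm u := by
  have hSu := sumNorm_pos hu
  have hSv := sumNorm_pos hv
  have e : normalized u - normalized v =
      (sumNorm u)⁻¹ • (u - v) + ((sumNorm u)⁻¹ - (sumNorm v)⁻¹) • v := by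
    simp only [normalized, smul_sub, sub_smul]
    abel
  have h2 : |(sumNorm u)⁻¹ - (sumNorm v)⁻¹| * sumNorm v = |sumNorm v - sumNorm u| / sumNorm u := by
    rw [inv_sub_inv hSu.ne' hSv.ne', abs_div, abs_of_pos (mul_pos hSu hSv)]
    field_simp
  rw [e]
  refine (sumNorm_add_le _ _).trans ?_
  rw [sumNorm_smul, sumNorm_smul, h2, abs_of_pos (inv_pos.2 hSu), abs_sub_comm]
  have := div_le_div_of_nonneg_right (abs_sumNorm_sub_le u v) hSu.le
  rw [mul_div_assoc, inv_mul_eq_div]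
  linarith

end SumNorm

section Kernel

variable {n m : ℕ} {𝕜 : Type*} [RCLike 𝕜]

/-- The Lipschitz condition says nothing at `0`, so continuity is available only off that point;
this is enough. -/
theorem IsLipschitzKernel.measurable {Ω : (Fin m → EuclideanSpace ℝ (Fin n)) → 𝕜}
    (h : IsLipschitzKernel Ω) : Measurable Ω := by
  obtain ⟨α, C, hα, -, hC, hΩ⟩ := h
  refine measurable_of_continuousOn_compl_singleton 0 fun v hv => ContinuousAt.continuousWithinAt ?_
  have hv0 : v ≠ 0 := hv
  rw [ContinuousAt, tendsto_iff_norm_sub_tendsto_zero]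
  have hlim : Filter.Tendsto
      (fun u => C * (2 * sumNorm (v - u) / sumNorm v) ^ α) (nhds v) (nhds 0) := by
    have hc : Continuous fun u : Fin m → EuclideanSpace ℝ (Fin n) =>
        C * (2 * sumNorm (v - u) / sumNorm v) ^ α :=
      continuous_const.mul (((by fun_prop : Continuous fun u => 2 * sumNorm (v - u) / sumNorm v)
        ).rpow_const fun _ => .inr hα.le)
    have := hc.tendsto v
    simpa [sumNorm, Real.zero_rpow hα.ne'] using this
  refine tendsto_of_tendsto_of_tendsto_of_le_of_le' tendsto_const_nhds hlim
    (.of_forall fun _ => norm_nonneg _) ?_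
  filter_upwards [isOpen_compl_singleton.mem_nhds hv] with u hu
  rw [norm_sub_rev]
  refine (hΩ v u hv0 hu).trans ?_
  gcongr
  · exact sumNorm_nonneg _
  · exact sumNorm_normalized_sub_le hv0 hu

/-- Normalised vectors are at distance at most `2` from each other, so one nonzero `e` controls all
nonzero vectors; the value at `0` is added separately. -/
theorem IsLipschitzKernel.exists_bound {Ω : (Fin m → EuclideanSpace ℝ (Fin n)) → 𝕜}
    (h : IsLipschitzKernel Ω) : ∃ A : ℝ, 0 ≤ A ∧ ∀ u, ‖Ω u‖ ≤ A := by
  obtain ⟨α, C, hα, -, hC, hΩ⟩ := h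
  by_cases hex : ∃ e : Fin m → EuclideanSpace ℝ (Fin n), e ≠ 0
  · obtain ⟨e, he⟩ := hex
    refine ⟨‖Ω 0‖ + (‖Ω e‖ + C * 2 ^ α), by positivity, fun u => ?_⟩
    by_cases hu : u = 0
    · subst hu
      have : 0 ≤ ‖Ω e‖ + C * 2 ^ α := by positivity
      linarith
    · have h1 : ∀ v : Fin m → EuclideanSpace ℝ (Fin n), v ≠ 0 → sumNorm (normalized v) = 1 := by
        intro v hv
        rw [normalized, sumNorm_smul, abs_of_pos (inv_pos.2 (sumNorm_pos hv)),
          inv_mul_cancel₀ (sumNorm_pos hv).ne']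
      have h2 : sumNorm (normalized u - normalized e) ≤ 2 := by
        have h4 := sumNorm_add_le (normalized u) ((-1 : ℝ) • normalized e)
        rw [sumNorm_smul, h1 u hu, h1 e he] at h4
        rw [sub_eq_add_neg, ← neg_one_smul ℝ]
        norm_num at h4 ⊢
        linarith
      have h3 : ‖Ω u - Ω e‖ ≤ C * 2 ^ α := by
        refine (hΩ u e hu he).trans ?_
        gcongr
        exact sumNorm_nonneg _
      have h4 : ‖Ω u‖ ≤ ‖Ω e‖ + ‖Ω u - Ω e‖ := by
        simpa using norm_add_le (Ω e) (Ω u - Ω e)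
      linarith [norm_nonneg (Ω 0)]
  · push Not at hex
    exact ⟨‖Ω 0‖, norm_nonneg _, fun u => by rw [hex u]⟩

/-- The truncated kernel `t^{-m} Ω(u) |u|^{-m(n-1)} 1_{max |u_i| ≤ t}`. -/
noncomputable def truncatedKernel (Ω : (Fin m → EuclideanSpace ℝ (Fin n)) → 𝕜) (t : ℝ)
    (u : Fin m → EuclideanSpace ℝ (Fin n)) : 𝕜 :=
  if ‖u‖ ≤ t then (t ^ m)⁻¹ • (sumNorm u ^ (m * (n - 1)))⁻¹ • Ω u else 0

theorem measurable_truncatedKernel {Ω : (Fin m → EuclideanSpace ℝ (Fin n)) → 𝕜}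
    (hΩ : Measurable Ω) : Measurable (Function.uncurry (truncatedKernel Ω)) := by
  unfold truncatedKernel Function.uncurry
  refine Measurable.ite (measurableSet_le (by fun_prop) (by fun_prop)) ?_ measurable_const
  refine Measurable.smul (by fun_prop) (Measurable.smul ?_ (by fun_prop))
  exact ((continuous_sumNorm.measurable.comp measurable_snd).pow_const _).inv

theorem marcinkiewiczF_eq (Ω : (Fin m → EuclideanSpace ℝ (Fin n)) → 𝕜)
    (f : Fin m → EuclideanSpace ℝ (Fin n) → 𝕜) {t : ℝ} (ht : 0 ≤ t)
    (x : EuclideanSpace ℝ (Fin n)) :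
    marcinkiewiczF Ω f t x =
      ∫ y, truncatedKernel Ω t y * ∏ i, f i (x - y i) := by
  have hball : (univ.pi fun _ : Fin m => closedBall (0 : EuclideanSpace ℝ (Fin n)) t) =
      closedBall 0 t := (closedBall_pi 0 ht).symm
  rw [marcinkiewiczF, hball, ← integral_smul, ← integral_indicator measurableSet_closedBall]
  congr 1
  ext y
  by_cases hy : ‖y‖ ≤ t
  · rw [indicator_of_mem (mem_closedBall_zero_iff.2 hy), truncatedKernel, if_pos hy,
      smul_mul_assoc, smul_mul_assoc]
  · rw [indicator_of_notMem (by rwa [mem_closedBall_zero_iff]), truncatedKernel, if_neg hy,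
      zero_mul]

theorem marcinkiewiczF_eq' (Ω : (Fin m → EuclideanSpace ℝ (Fin n)) → 𝕜)
    (f : Fin m → EuclideanSpace ℝ (Fin n) → 𝕜) {t : ℝ} (ht : 0 ≤ t)
    (x : EuclideanSpace ℝ (Fin n)) :
    marcinkiewiczF Ω f t x =
      ∫ z : Fin m → EuclideanSpace ℝ (Fin n),
        truncatedKernel Ω t (fun i => x - z i) * ∏ i, f i (z i) := by
  have : (volume : Measure (EuclideanSpace ℝ (Fin n))).IsNegInvariant := inferInstance
  have : (volume : Measure (Fin m → EuclideanSpace ℝ (Fin n))).IsNegInvariant :=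
    inferInstance
  rw [marcinkiewiczF_eq Ω f ht,
    ← integral_sub_left_eq_self _ volume (fun _ : Fin m => x)]
  simp [Pi.sub_def]

end Kernel

/-! ### Product integrals and absolute convergence of `F_t` -/

theorem lintegral_fin_prod_eq_prod {m : ℕ} {X : Type*} [MeasureSpace X]
    [SigmaFinite (volume : Measure X)] {f : Fin m → X → ℝ≥0∞} (hf : ∀ i, Measurable (f i)) :
    ∫⁻ z : Fin m → X, ∏ i, f i (z i) = ∏ i, ∫⁻ z, f i z := by
  induction m with
  | zero => simp [volume_pi]
  | succ m ih =>
    have hmp := (volume_preserving_piFinSuccAbove (fun _ : Fin (m + 1) => X) 0).symm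
    rw [← hmp.lintegral_comp (f := fun z : Fin (m + 1) → X => ∏ i, f i (z i))
      (Finset.measurable_fun_prod _ fun i _ => (hf i).comp (measurable_pi_apply i))]
    simp only [Fin.prod_univ_succ, MeasurableEquiv.piFinSuccAbove_symm_apply,
      Fin.insertNthEquiv_apply, Fin.insertNth_zero, Fin.cons_zero, Fin.cons_succ]
    rw [← ih fun i => hf (Fin.succ i)]
    exact lintegral_prod_mul (hf 0).aemeasurable (Finset.measurable_fun_prod _ fun i _ =>
      (hf (Fin.succ i)).comp (measurable_pi_apply i)).aemeasurable

theorem setLIntegral_closedBall_prod_eq_prod {m n : ℕ}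
    {f : Fin m → EuclideanSpace ℝ (Fin n) → ℝ≥0∞} (hf : ∀ i, Measurable (f i))
    (c : EuclideanSpace ℝ (Fin n)) {R : ℝ} (hR : 0 ≤ R) :
    ∫⁻ z in closedBall (fun _ : Fin m => c) R, ∏ i, f i (z i) =
      ∏ i, ∫⁻ z in closedBall c R, f i z := by
  have e : ∀ z : Fin m → EuclideanSpace ℝ (Fin n),
      (closedBall (fun _ : Fin m => c) R).indicator (fun z => ∏ i, f i (z i)) z =
        ∏ i, (closedBall c R).indicator (f i) (z i) := by
    intro z
    rw [closedBall_pi _ hR]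
    by_cases hz : z ∈ univ.pi fun _ : Fin m => closedBall c R
    · rw [indicator_of_mem hz]
      exact Finset.prod_congr rfl fun i _ => (indicator_of_mem (hz i (mem_univ i)) _).symm
    · rw [indicator_of_notMem hz]
      simp only [mem_univ_pi, not_forall] at hz
      obtain ⟨i, hi⟩ := hz
      exact (Finset.prod_eq_zero (Finset.mem_univ i) (indicator_of_notMem hi _)).symm
  rw [← lintegral_indicator measurableSet_closedBall, lintegral_congr e,
    lintegral_fin_prod_eq_prod fun i => (hf i).indicator measurableSet_closedBall]
  simp_rw [lintegral_indicator measurableSet_closedBall]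

section Kernel

variable {n m : ℕ} {𝕜 : Type*} [RCLike 𝕜]

/-- As `|u| ≥ |u_i|` for each `i`, the singularity `|u|^{-m(n-1)}` is dominated by a product of
one-variable kernels. Absolute convergence of `F_t` thus reduces to `RieszIntegrable` for each
argument. -/
theorem enorm_truncatedKernel_le {Ω : (Fin m → EuclideanSpace ℝ (Fin n)) → 𝕜} {A : ℝ}
    (hA : ∀ u, ‖Ω u‖ ≤ A) {t : ℝ} (ht : 0 < t) (u : Fin m → EuclideanSpace ℝ (Fin n)) :
    ‖truncatedKernel Ω t u‖ₑ ≤ ENNReal.ofReal (t ^ m)⁻¹ * ENNReal.ofReal A *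
      (closedBall (0 : Fin m → EuclideanSpace ℝ (Fin n)) t).indicator
        (fun u => ∏ i, (‖u i‖ₑ ^ (n - 1))⁻¹) u := by
  by_cases hu : ‖u‖ ≤ t
  · rw [indicator_of_mem (mem_closedBall_zero_iff.2 hu), truncatedKernel, if_pos hu, enorm_smul,
      enorm_smul, Real.enorm_of_nonneg (by positivity), mul_assoc, mul_comm ‖(sumNorm u ^ _)⁻¹‖ₑ]
    gcongr
    · rw [← ofReal_norm]; exact ENNReal.ofReal_le_ofReal (hA u)
    · have hS : ‖(sumNorm u ^ (m * (n - 1)))⁻¹‖ₑ ≤ ((‖sumNorm u‖ₑ ^ (n - 1))⁻¹) ^ m := by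
        rw [← ENNReal.inv_pow, ← pow_mul, mul_comm m, ← enorm_pow]
        -- The inverse of `0` is `0` in `ℝ` and `∞` in `ℝ≥0∞`; the inequality survives this
        -- mismatch.
        by_cases h0 : sumNorm u ^ ((n - 1) * m) = 0
        · rw [h0, inv_zero, enorm_zero]; exact zero_le
        · rw [enorm_inv h0]
      refine hS.trans ?_
      calc ((‖sumNorm u‖ₑ ^ (n - 1))⁻¹) ^ m = ∏ _i : Fin m, (‖sumNorm u‖ₑ ^ (n - 1))⁻¹ := by simp
        _ ≤ _ := by
          refine Finset.prod_le_prod' fun i _ => ?_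
          gcongr 1
          gcongr 1
          rw [← ofReal_norm, Real.enorm_of_nonneg (sumNorm_nonneg u)]
          exact ENNReal.ofReal_le_ofReal (norm_apply_le_sumNorm u i)
  · rw [truncatedKernel, if_neg hu]; simp

theorem lintegral_truncatedKernel_mul_prod_le {Ω : (Fin m → EuclideanSpace ℝ (Fin n)) → 𝕜} {A : ℝ}
    (hA : ∀ u, ‖Ω u‖ ≤ A) {g : Fin m → EuclideanSpace ℝ (Fin n) → 𝕜}
    (hg : ∀ i, StronglyMeasurable (g i)) {t : ℝ} (ht : 0 < t) (x : EuclideanSpace ℝ (Fin n)) :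
    ∫⁻ z : Fin m → EuclideanSpace ℝ (Fin n),
        ‖truncatedKernel Ω t (fun i => x - z i) * ∏ i, g i (z i)‖ₑ ≤
      ENNReal.ofReal (t ^ m)⁻¹ * ENNReal.ofReal A *
        ∏ i, ∫⁻ z in closedBall x t, (‖x - z‖ₑ ^ (n - 1))⁻¹ * ‖g i z‖ₑ := by
  have hmeas : ∀ i, Measurable fun z => (‖x - z‖ₑ ^ (n - 1))⁻¹ * ‖g i z‖ₑ := fun i =>
    (by fun_prop : Measurable fun z => (‖x - z‖ₑ ^ (n - 1))⁻¹).mul (hg i).measurable.enorm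
  rw [← setLIntegral_closedBall_prod_eq_prod hmeas x ht.le,
    ← lintegral_indicator measurableSet_closedBall, ← lintegral_const_mul' _ _ (by finiteness)]
  refine lintegral_mono fun z => ?_
  rw [enorm_mul]
  refine (mul_le_mul_left (enorm_truncatedKernel_le hA ht _) _).trans_eq ?_
  rw [mul_assoc _ _ ‖_‖ₑ]
  congr 1
  have hiff : (fun i => x - z i) ∈ closedBall (0 : Fin m → EuclideanSpace ℝ (Fin n)) t ↔
      z ∈ closedBall (fun _ : Fin m => x) t := by
    rw [mem_closedBall_zero_iff, mem_closedBall_iff_norm', Pi.sub_def]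
  by_cases hz : z ∈ closedBall (fun _ : Fin m => x) t
  · rw [indicator_of_mem hz, indicator_of_mem (hiff.2 hz), Finset.prod_mul_distrib]
    congr 1
    simp only [← ofReal_norm, norm_prod]
    rw [ENNReal.ofReal_prod_of_nonneg fun _ _ => norm_nonneg _]
  · rw [indicator_of_notMem hz, indicator_of_notMem (fun h => hz (hiff.1 h)), zero_mul]

theorem stronglyMeasurable_truncatedKernel_mul_prod
    {Ω : (Fin m → EuclideanSpace ℝ (Fin n)) → 𝕜} (hΩ : Measurable Ω)
    {g : Fin m → EuclideanSpace ℝ (Fin n) → 𝕜} (hg : ∀ i, StronglyMeasurable (g i)) :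
    StronglyMeasurable fun p : (ℝ × EuclideanSpace ℝ (Fin n)) × (Fin m → EuclideanSpace ℝ (Fin n)) =>
      truncatedKernel Ω p.1.1 (fun i => p.1.2 - p.2 i) * ∏ i, g i (p.2 i) := by
  refine StronglyMeasurable.mul ?_ ?_
  · have h : Measurable
        fun p : (ℝ × EuclideanSpace ℝ (Fin n)) × (Fin m → EuclideanSpace ℝ (Fin n)) =>
          (p.1.1, fun i => p.1.2 - p.2 i) :=
      (measurable_fst.comp measurable_fst).prodMk (measurable_pi_lambda _ fun i =>
        (measurable_snd.comp measurable_fst).sub ((measurable_pi_apply i).comp measurable_snd))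
    have h2 := (measurable_truncatedKernel hΩ).comp h
    exact h2.stronglyMeasurable
  · exact Finset.stronglyMeasurable_fun_prod _ fun i _ =>
      (hg i).comp_measurable ((measurable_pi_apply i).comp measurable_snd)

theorem integrable_truncatedKernel_mul_prod {Ω : (Fin m → EuclideanSpace ℝ (Fin n)) → 𝕜}
    (hΩ : Measurable Ω) {A : ℝ} (hA : ∀ u, ‖Ω u‖ ≤ A)
    {g : Fin m → EuclideanSpace ℝ (Fin n) → 𝕜} (hg : ∀ i, StronglyMeasurable (g i))
    (hr : ∀ i, RieszIntegrable (g i)) {t : ℝ} (ht : 0 < t) (x : EuclideanSpace ℝ (Fin n)) :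
    Integrable fun z : Fin m → EuclideanSpace ℝ (Fin n) =>
      truncatedKernel Ω t (fun i => x - z i) * ∏ i, g i (z i) := by
  refine ⟨((stronglyMeasurable_truncatedKernel_mul_prod hΩ hg).comp_measurable
    (measurable_prodMk_left (x := (t, x)))).aestronglyMeasurable, ?_⟩
  refine lt_of_le_of_lt (lintegral_truncatedKernel_mul_prod_le hA hg ht x) ?_
  refine ENNReal.mul_lt_top (by finiteness) (ENNReal.prod_lt_top fun i _ => hr i x t)

/-! ### Regularity of the truncated kernel -/

/-- Regularity of the truncated kernel away from the origin, with constant `K` and exponent `β`. -/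
def TruncatedKernelRegular (Ω : (Fin m → EuclideanSpace ℝ (Fin n)) → 𝕜) (K β : ℝ) : Prop :=
  ∀ (u v : Fin m → EuclideanSpace ℝ (Fin n)) (t r D : ℝ), 0 < r → 8 * r ≤ D → 0 < t →
    (∀ i, ‖u i - v i‖ ≤ 2 * r) → |‖u‖ - D| ≤ r → |‖v‖ - D| ≤ r →
    ‖truncatedKernel Ω t u - truncatedKernel Ω t v‖ ≤ K * (D ^ (m * (n - 1)))⁻¹ *
      ((Ici (D / 2)).indicator (fun t => (r / D) ^ β * (t ^ m)⁻¹) t +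
        (Icc (D - r) (D + r)).indicator (fun t => (t ^ m)⁻¹) t)

/-- If both points lie inside the cutoff, the difference is controlled by the Lipschitz condition on
`Ω` and the mean value bound for `|u|^{-m(n-1)}`. If only one does, `t` lies between `‖u‖` and
`‖v‖`, hence within `r` of `D`, and a size bound is enough. -/
theorem IsLipschitzKernel.exists_truncatedKernelRegular
    {Ω : (Fin m → EuclideanSpace ℝ (Fin n)) → 𝕜} (h : IsLipschitzKernel Ω) :
    ∃ K β : ℝ, 0 ≤ K ∧ 0 < β ∧ β ≤ 1 / 2 ∧ TruncatedKernelRegular Ω K β := by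
  obtain ⟨A, hA0, hA⟩ := h.exists_bound
  obtain ⟨α, C, hα, -, hC, hΩ⟩ := h
  set N := m * (n - 1) with hN
  -- The cap `1/2` matches the power of `r / D` in the `L²(dt/t)` norm of the cutoff term, bounded
  -- in `eLpNorm_indicator_Icc_inv_pow_le`.
  set β := min α (1 / 2)
  have hβ : 0 < β := lt_min hα (by norm_num)
  refine ⟨C * (8 * m) ^ α * 2 ^ N + A * (4 * m * N * 2 ^ N) + A * 2 ^ N, β, by positivity, hβ,
    min_le_right _ _, ?_⟩
  intro u v t r D hr hD ht huv hu hv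
  have hD0 : 0 < D := by linarith
  rw [abs_le] at hu hv
  have hS : ∀ w : Fin m → EuclideanSpace ℝ (Fin n), -r ≤ ‖w‖ - D → w ≠ 0 ∧ D / 2 ≤ sumNorm w := by
    intro w hw
    refine ⟨fun h0 => ?_, ?_⟩
    · rw [h0, norm_zero] at hw; linarith
    · linarith [norm_le_sumNorm w]
  obtain ⟨hu0, hSu⟩ := hS u hu.1
  obtain ⟨hv0, hSv⟩ := hS v hv.1
  have hSub : sumNorm (u - v) ≤ m * (2 * r) := sumNorm_le_of_forall_le huv
  have hrD : 0 < r / D := by positivity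
  have hrD1 : r / D ≤ 1 := (div_le_one hD0).2 (by linarith)
  have hinv : ∀ w : Fin m → EuclideanSpace ℝ (Fin n), D / 2 ≤ sumNorm w →
      (sumNorm w)⁻¹ ≤ 2 / D := by
    intro w hw
    rw [← inv_div]
    exact inv_anti₀ (by positivity) hw
  have hinvN : ∀ w : Fin m → EuclideanSpace ℝ (Fin n), D / 2 ≤ sumNorm w →
      (sumNorm w ^ N)⁻¹ ≤ 2 ^ N * (D ^ N)⁻¹ := by
    intro w hw
    rw [← inv_pow, ← div_eq_mul_inv, ← div_pow]
    exact pow_le_pow_left₀ (inv_nonneg.2 (sumNorm_nonneg w)) (hinv w hw) N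
  have hone : ∀ w : Fin m → EuclideanSpace ℝ (Fin n), D / 2 ≤ sumNorm w →
      ‖(t ^ m)⁻¹ • (sumNorm w ^ N)⁻¹ • Ω w‖ ≤ A * 2 ^ N * (D ^ N)⁻¹ * (t ^ m)⁻¹ := by
    intro w hw
    have := sumNorm_nonneg w
    rw [norm_smul, norm_smul, Real.norm_of_nonneg (by positivity),
      Real.norm_of_nonneg (by positivity)]
    calc (t ^ m)⁻¹ * ((sumNorm w ^ N)⁻¹ * ‖Ω w‖) ≤ (t ^ m)⁻¹ * ((2 ^ N * (D ^ N)⁻¹) * A) := by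
          gcongr
          · exact hinvN w hw
          · exact hA w
      _ = _ := by ring
  have hcut : t ∈ Icc (D - r) (D + r) → ∀ w : Fin m → EuclideanSpace ℝ (Fin n),
      D / 2 ≤ sumNorm w → ‖(t ^ m)⁻¹ • (sumNorm w ^ N)⁻¹ • Ω w‖ ≤
      (C * (8 * m) ^ α * 2 ^ N + A * (4 * m * N * 2 ^ N) + A * 2 ^ N) * (D ^ N)⁻¹ *
      ((Ici (D / 2)).indicator (fun t => (r / D) ^ β * (t ^ m)⁻¹) t +
        (Icc (D - r) (D + r)).indicator (fun t => (t ^ m)⁻¹) t) := by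
    intro htm w hw
    rw [indicator_of_mem htm]
    calc _ ≤ A * 2 ^ N * (D ^ N)⁻¹ * (t ^ m)⁻¹ := hone w hw
      _ ≤ (C * (8 * m) ^ α * 2 ^ N + A * (4 * m * N * 2 ^ N) + A * 2 ^ N) * (D ^ N)⁻¹ *
          (t ^ m)⁻¹ := by
          gcongr
          have : 0 ≤ C * (8 * m) ^ α * 2 ^ N + A * (4 * m * N * 2 ^ N) := by positivity
          linarith
      _ ≤ _ := by
          gcongr
          refine le_add_of_nonneg_left (indicator_nonneg (fun s hs => ?_) _)
          have : 0 < s := lt_of_lt_of_le (by positivity) hs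
          positivity
  by_cases hut : ‖u‖ ≤ t <;> by_cases hvt : ‖v‖ ≤ t
  · have htD : t ∈ Ici (D / 2) := by rw [mem_Ici]; linarith
    rw [truncatedKernel, truncatedKernel, if_pos hut, if_pos hvt, indicator_of_mem htD]
    have hΩd : ‖Ω u - Ω v‖ ≤ C * (8 * m) ^ α * (r / D) ^ β := by
      calc ‖Ω u - Ω v‖ ≤ C * sumNorm (normalized u - normalized v) ^ α := hΩ u v hu0 hv0
        _ ≤ C * (8 * m * (r / D)) ^ α := by
          gcongr
          · exact sumNorm_nonneg _
          · refine (sumNorm_normalized_sub_le hu0 hv0).trans ?_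
            calc 2 * sumNorm (u - v) / sumNorm u ≤ 2 * (m * (2 * r)) / (D / 2) := by
                  gcongr
              _ = 8 * m * (r / D) := by field_simp; ring
        _ = C * (8 * m) ^ α * (r / D) ^ α := by
          rw [Real.mul_rpow (by positivity) hrD.le, mul_assoc]
        _ ≤ _ := mul_le_mul_of_nonneg_left
          (Real.rpow_le_rpow_of_exponent_ge hrD hrD1 (min_le_left _ _)) (by positivity)
    have hSd : |(sumNorm u ^ N)⁻¹ - (sumNorm v ^ N)⁻¹| ≤
        4 * m * N * 2 ^ N * (D ^ N)⁻¹ * (r / D) ^ β := by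
      have h0u : 0 < sumNorm u := sumNorm_pos hu0
      have h0v : 0 < sumNorm v := sumNorm_pos hv0
      have hd1 : |(sumNorm u)⁻¹ - (sumNorm v)⁻¹| ≤ 2 * m * r * (2 / D) * (2 / D) := by
        rw [inv_sub_inv h0u.ne' h0v.ne', abs_div, abs_of_pos (mul_pos h0u h0v), abs_sub_comm,
          div_eq_mul_inv, mul_inv, ← mul_assoc]
        gcongr
        · exact (abs_sumNorm_sub_le u v).trans (hSub.trans_eq (by ring))
        · exact hinv u hSu
        · exact hinv v hSv
      rw [← inv_pow, ← inv_pow]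
      refine (abs_pow_sub_pow_le _ _ _).trans ?_
      rcases Nat.eq_zero_or_pos N with hN0 | hN0
      · rw [hN0]; simp
      · obtain ⟨M, hM⟩ : ∃ M, N = M + 1 := ⟨N - 1, by omega⟩
        have hmax : max |(sumNorm u)⁻¹| |(sumNorm v)⁻¹| ≤ 2 / D := by
          rw [abs_of_pos (inv_pos.2 h0u), abs_of_pos (inv_pos.2 h0v)]
          exact max_le (hinv u hSu) (hinv v hSv)
        calc _ ≤ (2 * m * r * (2 / D) * (2 / D)) * N * (2 / D) ^ (N - 1) := by gcongr
          _ = 4 * m * N * 2 ^ N * (D ^ N)⁻¹ * (r / D) := by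
            rw [hM, Nat.add_sub_cancel, div_pow]; field_simp; ring
          _ ≤ _ := by
            gcongr
            calc r / D = (r / D) ^ (1 : ℝ) := (Real.rpow_one _).symm
              _ ≤ _ := Real.rpow_le_rpow_of_exponent_ge hrD hrD1
                ((min_le_right _ _).trans (by norm_num))
    have e : (t ^ m)⁻¹ • (sumNorm u ^ N)⁻¹ • Ω u - (t ^ m)⁻¹ • (sumNorm v ^ N)⁻¹ • Ω v =
        (t ^ m)⁻¹ • ((sumNorm u ^ N)⁻¹ • (Ω u - Ω v) +
          ((sumNorm u ^ N)⁻¹ - (sumNorm v ^ N)⁻¹) • Ω v) := by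
      simp only [smul_sub, sub_smul, smul_add]; abel
    rw [e, norm_smul, Real.norm_of_nonneg (by positivity)]
    have h0 : 0 ≤ (Icc (D - r) (D + r)).indicator (fun t => (t ^ m)⁻¹) t := by
      refine indicator_nonneg (fun s hs => ?_) _
      have : 0 < s := lt_of_lt_of_le (by linarith) hs.1
      positivity
    calc (t ^ m)⁻¹ * ‖(sumNorm u ^ N)⁻¹ • (Ω u - Ω v) +
          ((sumNorm u ^ N)⁻¹ - (sumNorm v ^ N)⁻¹) • Ω v‖
        ≤ (t ^ m)⁻¹ * (2 ^ N * (D ^ N)⁻¹ * (C * (8 * m) ^ α * (r / D) ^ β) +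
          4 * m * N * 2 ^ N * (D ^ N)⁻¹ * (r / D) ^ β * A) := by
          gcongr
          refine (norm_add_le _ _).trans (add_le_add ?_ ?_)
          · rw [norm_smul, Real.norm_of_nonneg (inv_nonneg.2 (pow_nonneg (sumNorm_nonneg u) _))]
            gcongr
            exact hinvN u hSu
          · rw [norm_smul, Real.norm_eq_abs]
            exact mul_le_mul hSd (hA v) (norm_nonneg _) (by positivity)
      _ = (C * (8 * m) ^ α * 2 ^ N + A * (4 * m * N * 2 ^ N)) * (D ^ N)⁻¹ *
          ((r / D) ^ β * (t ^ m)⁻¹ + 0) := by ring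
      _ ≤ _ := by
          refine mul_le_mul (mul_le_mul_of_nonneg_right
            (le_add_of_nonneg_right (by positivity)) (by positivity)) ?_ (by positivity)
            (by positivity)
          gcongr
  · rw [truncatedKernel, truncatedKernel, if_pos hut, if_neg hvt, sub_zero]
    exact hcut ⟨by linarith, by linarith⟩ u hSu
  · rw [truncatedKernel, truncatedKernel, if_neg hut, if_pos hvt, zero_sub, norm_neg]
    exact hcut ⟨by linarith, by linarith⟩ v hSv
  · rw [truncatedKernel, truncatedKernel, if_neg hut, if_neg hvt, sub_zero, norm_zero]
    have h1 : 0 ≤ (Icc (D - r) (D + r)).indicator (fun t => (t ^ m)⁻¹) t := by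
      refine indicator_nonneg (fun s hs => ?_) _
      have : 0 < s := lt_of_lt_of_le (by linarith) hs.1
      positivity
    have h2 : 0 ≤ (Ici (D / 2)).indicator (fun t => (r / D) ^ β * (t ^ m)⁻¹) t := by
      refine indicator_nonneg (fun s hs => ?_) _
      have : 0 < s := lt_of_lt_of_le (by positivity) hs
      positivity
    positivity

end Kernel

/-! ### The square function with respect to `dt / t` -/

/-- The measure `dt / t` on `(0, ∞)`. -/
noncomputable def logMeasure : Measure ℝ :=
  (volume.restrict (Ioi 0)).withDensity fun t => (ENNReal.ofReal t)⁻¹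

instance : SFinite logMeasure := by unfold logMeasure; infer_instance

theorem lintegral_logMeasure (h : ℝ → ℝ≥0∞) :
    ∫⁻ t, h t ∂logMeasure = ∫⁻ t in Ioi 0, h t / ENNReal.ofReal t := by
  rw [logMeasure, lintegral_withDensity_eq_lintegral_mul_non_measurable₀ _ (by fun_prop)]
  · simp [div_eq_mul_inv, mul_comm]
  · filter_upwards [ae_restrict_mem measurableSet_Ioi] with t ht
    have : 0 < t := ht
    simpa using this

theorem ae_logMeasure_pos : ∀ᵐ t ∂logMeasure, 0 < t :=
  (withDensity_absolutelyContinuous _ _).ae_le (ae_restrict_mem measurableSet_Ioi)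

theorem eLpNorm_two_logMeasure {F : Type*} [NormedAddCommGroup F] (h : ℝ → F) :
    eLpNorm h 2 logMeasure = (∫⁻ t in Ioi 0, ‖h t‖ₑ ^ 2 / ENNReal.ofReal t) ^ (1 / 2 : ℝ) := by
  rw [eLpNorm_eq_lintegral_rpow_enorm_toReal (by norm_num) (by norm_num), lintegral_logMeasure]
  simp

theorem marcinkiewicz_eq_eLpNorm {n m : ℕ} {𝕜 : Type*} [RCLike 𝕜]
    (Ω : (Fin m → EuclideanSpace ℝ (Fin n)) → 𝕜)
    (f : Fin m → EuclideanSpace ℝ (Fin n) → 𝕜) (x : EuclideanSpace ℝ (Fin n)) :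
    marcinkiewicz Ω f x = eLpNorm (fun t => marcinkiewiczF Ω f t x) 2 logMeasure :=
  (eLpNorm_two_logMeasure _).symm

/-- **Minkowski's integral inequality** in `L²`. -/
theorem eLpNorm_two_integral_le {X Y F : Type*} [MeasurableSpace X] [MeasurableSpace Y]
    [NormedAddCommGroup F] [NormedSpace ℝ F] {μ : Measure X} {ν : Measure Y} [SFinite μ]
    [SFinite ν] {H : X → Y → F} (hH : StronglyMeasurable (Function.uncurry H)) :
    eLpNorm (fun x => ∫ y, H x y ∂ν) 2 μ ≤ ∫⁻ y, eLpNorm (fun x => H x y) 2 μ ∂ν := by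
  have hform : ∀ h : X → F, eLpNorm h 2 μ = (∫⁻ x, ‖h x‖ₑ ^ (2 : ℝ) ∂μ) ^ (1 / 2 : ℝ) := fun h => by
    rw [eLpNorm_eq_lintegral_rpow_enorm_toReal (by norm_num) (by norm_num)]
    simp
  have hmeas : Measurable (Function.uncurry fun x y => ‖H x y‖ₑ) := hH.enorm
  have hx : ∀ x, Measurable fun y => ‖H x y‖ₑ := fun x => hmeas.comp measurable_prodMk_left
  have hy : ∀ y, Measurable fun x => ‖H x y‖ₑ := fun y => hmeas.comp measurable_prodMk_right
  set N : Y → ℝ≥0∞ := fun y => eLpNorm (fun x => H x y) 2 μ with hN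
  have hNm : Measurable N := by
    simp only [hN, hform]
    refine Measurable.pow_const ?_ _
    exact Measurable.lintegral_prod_left' (f := fun p : X × Y => ‖H p.1 p.2‖ₑ ^ (2 : ℝ))
      (hmeas.pow_const _)
  -- Expand the square as a double integral in `y, y'`, exchange the order, and apply Cauchy–Schwarz
  -- in `x`.
  have key : ∫⁻ x, ‖∫ y, H x y ∂ν‖ₑ ^ (2 : ℝ) ∂μ ≤ (∫⁻ y, N y ∂ν) ^ (2 : ℝ) := by
    calc ∫⁻ x, ‖∫ y, H x y ∂ν‖ₑ ^ (2 : ℝ) ∂μ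
        ≤ ∫⁻ x, ∫⁻ y, ∫⁻ y', ‖H x y‖ₑ * ‖H x y'‖ₑ ∂ν ∂ν ∂μ := by
          refine lintegral_mono fun x => ?_
          calc ‖∫ y, H x y ∂ν‖ₑ ^ (2 : ℝ) ≤ (∫⁻ y, ‖H x y‖ₑ ∂ν) ^ (2 : ℝ) := by
                gcongr; exact enorm_integral_le_lintegral_enorm _
            _ = (∫⁻ y, ‖H x y‖ₑ ∂ν) * ∫⁻ y, ‖H x y‖ₑ ∂ν := by
                rw [ENNReal.rpow_two, sq]
            _ = _ := by
                simp_rw [lintegral_const_mul _ (hx x)]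
                rw [lintegral_mul_const _ (hx x)]
      _ = ∫⁻ y, ∫⁻ y', ∫⁻ x, ‖H x y‖ₑ * ‖H x y'‖ₑ ∂μ ∂ν ∂ν := by
          have h3 : Measurable fun p : (X × Y) × Y => ‖H p.1.1 p.1.2‖ₑ * ‖H p.1.1 p.2‖ₑ :=
            (hmeas.comp measurable_fst).mul
              (hmeas.comp ((measurable_fst.comp measurable_fst).prodMk measurable_snd))
          rw [lintegral_lintegral_swap]
          · refine lintegral_congr fun y => ?_
            rw [lintegral_lintegral_swap]
            exact (h3.comp ((measurable_fst.prodMk measurable_const).prodMk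
              measurable_snd)).aemeasurable
          · exact (Measurable.lintegral_prod_right' h3).aemeasurable
      _ ≤ ∫⁻ y, ∫⁻ y', N y * N y' ∂ν ∂ν := by
          refine lintegral_mono fun y => lintegral_mono fun y' => ?_
          simp only [hN, hform]
          exact ENNReal.lintegral_mul_le_Lp_mul_Lq μ
            (Real.holderConjugate_iff.2 ⟨by norm_num, by norm_num⟩)
            (hy y).aemeasurable (hy y').aemeasurable
      _ = (∫⁻ y, N y ∂ν) ^ (2 : ℝ) := by
          simp_rw [lintegral_const_mul _ hNm]
          rw [lintegral_mul_const _ hNm, ENNReal.rpow_two, sq]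
  rw [hform]
  calc _ ≤ ((∫⁻ y, N y ∂ν) ^ (2 : ℝ)) ^ (1 / 2 : ℝ) := by gcongr
    _ = _ := by rw [← ENNReal.rpow_mul]; norm_num

theorem ENNReal.rpow_half_le_ofReal {a : ℝ≥0∞} {s : ℝ} (hs : 0 ≤ s)
    (h : a ≤ ENNReal.ofReal (s ^ 2)) : a ^ (1 / 2 : ℝ) ≤ ENNReal.ofReal s := by
  calc a ^ (1 / 2 : ℝ) ≤ (ENNReal.ofReal (s ^ 2)) ^ (1 / 2 : ℝ) := by gcongr
    _ = ENNReal.ofReal s := by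
      rw [ENNReal.ofReal_pow hs, ← ENNReal.rpow_two, ← ENNReal.rpow_mul]; norm_num

theorem enorm_sq_div_ofReal {t s : ℝ} (ht : 0 < t) :
    ‖s‖ₑ ^ 2 / ENNReal.ofReal t = ENNReal.ofReal (s ^ 2 / t) := by
  rw [ENNReal.ofReal_div_of_pos ht, ← ofReal_norm, ← ENNReal.ofReal_pow (norm_nonneg _),
    Real.norm_eq_abs, sq_abs]

theorem eLpNorm_indicator_Ici_inv_pow_le {m : ℕ} (hm : 1 ≤ m) {s : ℝ} (hs : 0 < s) :
    eLpNorm ((Ici s).indicator fun t => (t ^ m)⁻¹) 2 logMeasure ≤ ENNReal.ofReal (s ^ m)⁻¹ := by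
  rw [eLpNorm_two_logMeasure]
  refine ENNReal.rpow_half_le_ofReal (by positivity) ?_
  -- For `t ≥ s` and `m ≥ 1` this dominates `t^{-2m-1}`, and its integral over `(s, ∞)` is exactly
  -- `s^{-2m}`.
  set w : ℝ → ℝ := fun t => (s ^ (2 * m - 1))⁻¹ * t ^ (-2 : ℝ)
  have hw : IntegrableOn w (Ioi s) :=
    (integrableOn_Ioi_rpow_of_lt (by norm_num) hs).const_mul _
  calc ∫⁻ t in Ioi 0, ‖(Ici s).indicator (fun t => (t ^ m)⁻¹) t‖ₑ ^ 2 / ENNReal.ofReal t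
      ≤ ∫⁻ t in Ioi 0, (Ici s).indicator (fun t => ENNReal.ofReal (w t)) t := by
        refine setLIntegral_mono' measurableSet_Ioi fun t ht => ?_
        have ht0 : 0 < t := ht
        by_cases hts : t ∈ Ici s
        · rw [indicator_of_mem hts, indicator_of_mem hts, enorm_sq_div_ofReal ht0]
          refine ENNReal.ofReal_le_ofReal ?_
          have hst : s ≤ t := hts
          obtain ⟨k, hk⟩ : ∃ k, m = k + 1 := ⟨m - 1, by omega⟩
          have e : 2 * m - 1 = 2 * k + 1 := by omega
          simp only [w]
          rw [e, Real.rpow_neg ht0.le, Real.rpow_two, ← mul_inv, inv_pow, div_eq_mul_inv, ← mul_inv]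
          refine inv_anti₀ (by positivity) ?_
          calc s ^ (2 * k + 1) * t ^ 2 ≤ t ^ (2 * k + 1) * t ^ 2 := by gcongr
            _ = (t ^ m) ^ 2 * t := by rw [hk]; ring
        · rw [indicator_of_notMem hts]; simp
    _ ≤ ∫⁻ t, (Ici s).indicator (fun t => ENNReal.ofReal (w t)) t := setLIntegral_le_lintegral _ _
    _ = ∫⁻ t in Ioi s, ENNReal.ofReal (w t) := by
        rw [lintegral_indicator measurableSet_Ici]
        exact setLIntegral_congr Ioi_ae_eq_Ici.symm
    _ = ENNReal.ofReal (∫ t in Ioi s, w t) := by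
        rw [ofReal_integral_eq_lintegral_ofReal hw]
        filter_upwards [ae_restrict_mem measurableSet_Ioi] with t ht
        have : 0 < t := hs.trans ht
        simp only [w, Pi.zero_apply]
        positivity
    _ ≤ _ := by
        refine ENNReal.ofReal_le_ofReal (le_of_eq ?_)
        simp only [w]
        rw [integral_const_mul, integral_Ioi_rpow_of_lt (by norm_num) hs]
        obtain ⟨k, hk⟩ : ∃ k, m = k + 1 := ⟨m - 1, by omega⟩
        have e : 2 * m - 1 = 2 * k + 1 := by omega
        rw [e, hk, show (-2 : ℝ) + 1 = -1 by norm_num, Real.rpow_neg_one]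
        field_simp
        ring

/-- The interval has length `2 r` and lies above `D / 2`, so its `dt/t` mass is `O(r / D)`; the `L²`
norm takes the square root. -/
theorem eLpNorm_indicator_Icc_inv_pow_le (m : ℕ) {r D : ℝ} (hr : 0 < r) (hD : 8 * r ≤ D) :
    eLpNorm ((Icc (D - r) (D + r)).indicator fun t => (t ^ m)⁻¹) 2 logMeasure ≤
      ENNReal.ofReal (2 ^ (m + 1) * (D ^ m)⁻¹ * (r / D) ^ (1 / 2 : ℝ)) := by
  have hD0 : 0 < D := by linarith
  rw [eLpNorm_two_logMeasure]
  refine ENNReal.rpow_half_le_ofReal (by positivity) ?_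
  calc ∫⁻ t in Ioi 0, ‖(Icc (D - r) (D + r)).indicator (fun t => (t ^ m)⁻¹) t‖ₑ ^ 2 /
        ENNReal.ofReal t
      ≤ ∫⁻ t in Ioi 0, (Icc (D - r) (D + r)).indicator
          (fun _ => ENNReal.ofReal (((D / 2) ^ m)⁻¹ ^ 2 / (D / 2))) t := by
        refine setLIntegral_mono' measurableSet_Ioi fun t ht => ?_
        have ht0 : 0 < t := ht
        by_cases hts : t ∈ Icc (D - r) (D + r)
        · rw [indicator_of_mem hts, indicator_of_mem hts, enorm_sq_div_ofReal ht0]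
          refine ENNReal.ofReal_le_ofReal ?_
          have : D / 2 ≤ t := by linarith [hts.1]
          gcongr
        · rw [indicator_of_notMem hts]; simp
    _ ≤ ENNReal.ofReal (((D / 2) ^ m)⁻¹ ^ 2 / (D / 2)) * volume (Icc (D - r) (D + r)) := by
        refine (setLIntegral_le_lintegral _ _).trans_eq ?_
        rw [lintegral_indicator_const measurableSet_Icc]
    _ = _ := by
        rw [Real.volume_Icc, ← ENNReal.ofReal_mul (by positivity)]
        congr 1
        rw [mul_pow, ← Real.rpow_natCast ((r / D) ^ (1 / 2 : ℝ)), ← Real.rpow_mul (by positivity)]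
        norm_num
        rw [div_pow]
        field_simp
        ring

section Kernel

variable {n m : ℕ} {𝕜 : Type*} [RCLike 𝕜]

/-- Taking the norm of `t^{-m}` in `t` gains `D^{-m}`, which turns `D^{-m(n-1)}` into the critical
`D^{-mn}`, with the factor `(r / D)^β` left over for summability. -/
theorem TruncatedKernelRegular.eLpNorm_sub_le {Ω : (Fin m → EuclideanSpace ℝ (Fin n)) → 𝕜}
    {K β : ℝ} (h : TruncatedKernelRegular Ω K β) (hm : 1 ≤ m) (hn : 1 ≤ n) (hK : 0 ≤ K)
    (hβ : β ≤ 1 / 2)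
    {u v : Fin m → EuclideanSpace ℝ (Fin n)} {r D : ℝ} (hr : 0 < r) (hD : 8 * r ≤ D)
    (huv : ∀ i, ‖u i - v i‖ ≤ 2 * r) (hu : |‖u‖ - D| ≤ r) (hv : |‖v‖ - D| ≤ r) :
    eLpNorm (fun t => truncatedKernel Ω t u - truncatedKernel Ω t v) 2 logMeasure ≤
      ENNReal.ofReal (3 * 2 ^ m * K * (D ^ (m * n))⁻¹ * (r / D) ^ β) := by
  have hD0 : 0 < D := by linarith
  have hrD : 0 < r / D := by positivity
  have hrD1 : r / D ≤ 1 := (div_le_one hD0).2 (by linarith)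
  set N := m * (n - 1) with hN
  have hNn : N + m = m * n := by
    obtain ⟨k, rfl⟩ : ∃ k, n = k + 1 := ⟨n - 1, by omega⟩
    simp [hN]; ring
  set g₁ : ℝ → ℝ := (Ici (D / 2)).indicator fun t => (t ^ m)⁻¹
  set g₂ : ℝ → ℝ := (Icc (D - r) (D + r)).indicator fun t => (t ^ m)⁻¹
  have hg₁ : Measurable g₁ := Measurable.indicator (by fun_prop) measurableSet_Ici
  have hg₂ : Measurable g₂ := Measurable.indicator (by fun_prop) measurableSet_Icc
  calc _ ≤ eLpNorm ((K * (D ^ N)⁻¹) • ((r / D) ^ β • g₁ + g₂)) 2 logMeasure := by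
        refine eLpNorm_mono_ae_real ?_
        filter_upwards [ae_logMeasure_pos] with t ht
        refine (h u v t r D hr hD ht huv hu hv).trans_eq ?_
        simp only [Pi.smul_apply, Pi.add_apply, smul_eq_mul]
        congr 2
        exact indicator_const_mul _ _ _ _
    _ ≤ ENNReal.ofReal (K * (D ^ N)⁻¹) * (ENNReal.ofReal ((r / D) ^ β) *
          ENNReal.ofReal ((D / 2) ^ m)⁻¹ +
          ENNReal.ofReal (2 ^ (m + 1) * (D ^ m)⁻¹ * (r / D) ^ (1 / 2 : ℝ))) := by
        rw [eLpNorm_const_smul, Real.enorm_of_nonneg (by positivity)]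
        gcongr
        refine (eLpNorm_add_le (hg₁.const_smul _).aestronglyMeasurable hg₂.aestronglyMeasurable
          (by norm_num)).trans (add_le_add ?_ ?_)
        · rw [eLpNorm_const_smul, Real.enorm_of_nonneg (by positivity)]
          gcongr
          exact eLpNorm_indicator_Ici_inv_pow_le hm (by positivity)
        · exact eLpNorm_indicator_Icc_inv_pow_le m hr hD
    _ ≤ _ := by
        rw [← ENNReal.ofReal_mul (by positivity), ← ENNReal.ofReal_add (by positivity)
          (by positivity), ← ENNReal.ofReal_mul (by positivity)]
        refine ENNReal.ofReal_le_ofReal ?_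
        have h1 : (r / D) ^ (1 / 2 : ℝ) ≤ (r / D) ^ β :=
          Real.rpow_le_rpow_of_exponent_ge hrD hrD1 hβ
        calc _ ≤ K * (D ^ N)⁻¹ * ((r / D) ^ β * ((D / 2) ^ m)⁻¹ +
              2 ^ (m + 1) * (D ^ m)⁻¹ * (r / D) ^ β) := by gcongr
          _ = _ := by rw [← hNn, pow_add, div_pow]; field_simp; ring

end Kernel

/-! ### Integration over the complement of `(B*)^m` -/

section Far

variable {n m : ℕ} {F : Type*} [NormedAddCommGroup F] [NormedSpace ℝ F] [CompleteSpace F]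

/-- The constant in the estimate of the integral away from a ball. -/
noncomputable def farConst (n m : ℕ) (β : ℝ) : ℝ≥0∞ :=
  ∑' k : ℕ, (2 ^ n * (1 + (k + 1) * 2 ^ n) *
    volume (closedBall (0 : EuclideanSpace ℝ (Fin n)) 1)) ^ m *
      ENNReal.ofReal (((2 : ℝ) ^ (-β)) ^ k)

theorem farConst_lt_top (n m : ℕ) {β : ℝ} (hβ : 0 < β) : farConst n m β < ∞ := by
  set ω := volume (closedBall (0 : EuclideanSpace ℝ (Fin n)) 1)
  have hω : ω ≠ ∞ := volume_closedBall_ne_top 0 1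
  set ρ : ℝ := 2 ^ (-β)
  have hρ0 : 0 < ρ := by positivity
  have hρ1 : ρ < 1 := Real.rpow_lt_one_of_one_lt_of_neg (by norm_num) (by linarith)
  have hsum : Summable fun k : ℕ => ρ⁻¹ * (((k + 1 : ℕ) : ℝ) ^ m * ρ ^ (k + 1)) :=
    ((summable_nat_add_iff 1).2 (summable_pow_mul_geometric_of_norm_lt_one m
      (r := ρ) (by rwa [Real.norm_of_nonneg hρ0.le]))).mul_left _
  have hle : ∀ k : ℕ, (2 ^ n * (1 + (k + 1) * 2 ^ n) * ω) ^ m * ENNReal.ofReal (ρ ^ k) ≤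
      (2 ^ n * (1 + 2 ^ n) * ω) ^ m *
        ENNReal.ofReal (ρ⁻¹ * (((k + 1 : ℕ) : ℝ) ^ m * ρ ^ (k + 1))) := by
    intro k
    have e : ρ⁻¹ * (((k + 1 : ℕ) : ℝ) ^ m * ρ ^ (k + 1)) = ((k + 1 : ℕ) : ℝ) ^ m * ρ ^ k := by
      rw [pow_succ]; field_simp
    rw [e, ENNReal.ofReal_mul (by positivity), ENNReal.ofReal_pow (Nat.cast_nonneg (k + 1)),
      ENNReal.ofReal_natCast, ← mul_assoc, ← mul_pow]
    refine mul_le_mul_left (pow_le_pow_left' ?_ m) _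
    have : (1 : ℝ≥0∞) ≤ k + 1 := le_add_self
    calc 2 ^ n * (1 + ((k : ℝ≥0∞) + 1) * 2 ^ n) * ω
        ≤ 2 ^ n * (((k : ℝ≥0∞) + 1) + (k + 1) * 2 ^ n) * ω := by gcongr
      _ = _ := by push_cast; ring
  refine lt_of_le_of_lt (ENNReal.tsum_le_tsum hle) ?_
  rw [ENNReal.tsum_mul_left]
  exact ENNReal.mul_lt_top (by finiteness) hsum.tsum_ofReal_lt_top

/-- The weight `D^{-mn} (r / D)^β`, where `D` is the distance to the diagonal point `c`. -/
noncomputable def farWeight (n m : ℕ) (β r D : ℝ) : ℝ≥0∞ :=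
  ENNReal.ofReal ((D ^ (m * n))⁻¹ * (r / D) ^ β)

theorem lintegral_compl_closedBall_le {β : ℝ} (hβ : 0 < β)
    {f : Fin m → EuclideanSpace ℝ (Fin n) → F} (hf : ∀ i, StronglyMeasurable (f i))
    (hl : ∀ i, LocallyIntegrable (f i) volume) {b : Fin m → ℝ≥0} (hb : ∀ i, bmoNorm (f i) ≤ b i)
    (c : EuclideanSpace ℝ (Fin n)) {r : ℝ} (hr : 0 < r) :
    ∫⁻ z in (closedBall (fun _ : Fin m => c) (8 * r))ᶜ,
        farWeight n m β r ‖z - fun _ => c‖ *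
          ∏ i, ‖f i (z i) - ballAverage (f i) c (8 * r)‖ₑ ≤
      farConst n m β * ∏ i, (b i : ℝ≥0∞) := by
  set G : (Fin m → EuclideanSpace ℝ (Fin n)) → ℝ≥0∞ :=
    fun z => ∏ i, ‖f i (z i) - ballAverage (f i) c (8 * r)‖ₑ with hG
  have hfm : ∀ i, Measurable fun z => ‖f i z - ballAverage (f i) c (8 * r)‖ₑ := fun i =>
    ((hf i).sub stronglyMeasurable_const).enorm
  have hGm : Measurable G := Finset.measurable_fun_prod _ fun i _ =>
    (hfm i).comp (measurable_pi_apply i)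
  let R : ℕ → ℝ := fun k => 2 ^ k * (8 * r)
  have hR : ∀ k, 0 < R k := fun k => by positivity
  -- An upper bound for the weight on the shell `R k ≤ D ≤ R (k + 1)`. The factor `(R k)^{-mn}` will
  -- cancel the volumes of the `m` balls, leaving a power of `k` times `2^{-βk}`.
  let wt : ℕ → ℝ≥0∞ := fun k => ENNReal.ofReal ((R k ^ (m * n))⁻¹ * ((2 : ℝ) ^ (-β)) ^ k)
  have hpt : ∀ z ∈ (closedBall (fun _ : Fin m => c) (8 * r))ᶜ,
      farWeight n m β r ‖z - fun _ => c‖ * G z ≤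
        ∑' k, (closedBall (fun _ : Fin m => c) (R (k + 1))).indicator (fun z => wt k * G z) z := by
    intro z hz
    set D := ‖z - fun _ => c‖ with hD
    have hzD : 8 * r < D := by
      rw [mem_compl_iff, mem_closedBall_iff_norm, not_le] at hz
      exact hz
    have hex : ∃ k : ℕ, D ≤ R (k + 1) := by
      obtain ⟨k, hk⟩ := pow_unbounded_of_one_lt (D / (8 * r)) (y := (2 : ℝ)) (by norm_num)
      refine ⟨k, ?_⟩
      rw [div_lt_iff₀ (by positivity)] at hk
      refine hk.le.trans ?_
      simp only [R]
      gcongr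
      · norm_num
      · omega
    classical
    have hk1 := Nat.find_spec hex
    have hk2 := fun j => Nat.find_min hex (m := j)
    set k := Nat.find hex
    have hRD : R k ≤ D := by
      rcases hk0 : k with _ | j
      · simpa [R] using hzD.le
      · rw [hk0] at hk2
        exact (not_le.1 (hk2 j (Nat.lt_succ_self j))).le
    refine le_trans ?_ (ENNReal.le_tsum k)
    rw [indicator_of_mem (by rwa [mem_closedBall_iff_norm])]
    gcongr
    refine ENNReal.ofReal_le_ofReal ?_
    have h0 := hR k
    have h1 : r / D ≤ (2 ^ k)⁻¹ := by
      calc r / D ≤ r / R k := by gcongr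
        _ = (2 ^ k)⁻¹ * 8⁻¹ := by simp only [R]; field_simp
        _ ≤ (2 ^ k)⁻¹ := mul_le_of_le_one_right (by positivity) (by norm_num)
    have h2 : ((2 : ℝ) ^ (-β)) ^ k = ((2 ^ k)⁻¹) ^ β := by
      rw [← Real.rpow_natCast, ← Real.rpow_mul (by norm_num), Real.inv_rpow (by positivity),
        ← Real.rpow_neg (by positivity), ← Real.rpow_natCast 2 k, ← Real.rpow_mul (by norm_num)]
      ring_nf
    rw [h2]
    have : 0 ≤ r / D := div_nonneg hr.le (h0.le.trans hRD)
    gcongr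
  have hterm : ∀ k : ℕ, ∫⁻ z in closedBall (fun _ : Fin m => c) (R (k + 1)), wt k * G z ≤
      ((2 ^ n * (1 + (k + 1) * 2 ^ n) * volume (closedBall (0 : EuclideanSpace ℝ (Fin n)) 1)) ^ m *
        ENNReal.ofReal (((2 : ℝ) ^ (-β)) ^ k)) * ∏ i, (b i : ℝ≥0∞) := by
    intro k
    have hvol : volume (closedBall c (R (k + 1))) =
        2 ^ n * ENNReal.ofReal (R k) ^ n *
          volume (closedBall (0 : EuclideanSpace ℝ (Fin n)) 1) := by
      have e : R (k + 1) = (2 * R k) * 1 := by simp only [R, pow_succ]; ring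
      rw [e, volume_closedBall_scale c 0 (by have := hR k; positivity) zero_le_one,
        ENNReal.ofReal_mul (by norm_num), mul_pow, ENNReal.ofReal_ofNat]
    rw [lintegral_const_mul _ hGm, setLIntegral_closedBall_prod_eq_prod hfm c (hR _).le]
    calc wt k * ∏ i, ∫⁻ z in closedBall c (R (k + 1)), ‖f i z - ballAverage (f i) c (8 * r)‖ₑ
        ≤ wt k * ∏ i, ((1 + ((k + 1 : ℕ) : ℝ≥0∞) * 2 ^ n) * b i *
            volume (closedBall c (R (k + 1)))) := by
          gcongr with i
          exact lintegral_sub_ballAverage_two_pow_le (hl i) (hb i) c (by positivity) (k + 1)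
      _ = ((ENNReal.ofReal (R k) ^ (m * n))⁻¹ * ENNReal.ofReal (R k) ^ (m * n)) *
          (((2 ^ n * (1 + (k + 1) * 2 ^ n) *
            volume (closedBall (0 : EuclideanSpace ℝ (Fin n)) 1)) ^ m *
            ENNReal.ofReal (((2 : ℝ) ^ (-β)) ^ k)) * ∏ i, (b i : ℝ≥0∞)) := by
          have h0 := hR k
          simp only [wt]
          rw [ENNReal.ofReal_mul (by positivity), ENNReal.ofReal_inv_of_pos (by positivity),
            ENNReal.ofReal_pow h0.le, hvol, Finset.prod_mul_distrib, Finset.prod_mul_distrib]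
          simp only [Finset.prod_const, Finset.card_univ, Fintype.card_fin]
          push_cast
          generalize (1 + ((k : ℝ≥0∞) + 1) * 2 ^ n) = X
          ring
      _ = _ := by
          rw [ENNReal.inv_mul_cancel (pow_ne_zero _ (by simpa using hR k)) (by finiteness), one_mul]
  calc _ ≤ ∫⁻ z in (closedBall (fun _ : Fin m => c) (8 * r))ᶜ, ∑' k,
          (closedBall (fun _ : Fin m => c) (R (k + 1))).indicator (fun z => wt k * G z) z :=
        setLIntegral_mono' measurableSet_closedBall.compl hpt
    _ ≤ ∑' k, ∫⁻ z in closedBall (fun _ : Fin m => c) (R (k + 1)), wt k * G z := by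
        refine (setLIntegral_le_lintegral _ _).trans_eq ?_
        rw [lintegral_tsum fun k =>
          ((hGm.const_mul _).indicator measurableSet_closedBall).aemeasurable]
        simp_rw [lintegral_indicator measurableSet_closedBall]
    _ ≤ _ := ENNReal.tsum_le_tsum hterm
    _ = _ := by rw [ENNReal.tsum_mul_right, farConst]

end Far

/-! ### Cancellation: constants do not contribute -/

section Cancellation

variable {n m : ℕ} {𝕜 : Type*} [RCLike 𝕜]

/-- In polar coordinates `w = s θ`, homogeneity moves the radius onto the other variables: `Ω(…, s
θ, …) = Ω(s⁻¹ y with θ in place j)`. The sphere integral vanishes for every choice of these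
variables, in particular for `s⁻¹ y`. -/
theorem integral_radial_smul_eq_zero (hn : 1 ≤ n) {Ω : (Fin m → EuclideanSpace ℝ (Fin n)) → 𝕜}
    (hhom : IsHomogeneousZero Ω) (hvan : HasVanishingSphereIntegrals Ω) (j : Fin m)
    (y : Fin m → EuclideanSpace ℝ (Fin n)) (φ : ℝ → ℝ) :
    ∫ w : EuclideanSpace ℝ (Fin n), φ ‖w‖ • Ω (Function.update y j w) = 0 := by
  have : Nonempty (Fin n) := ⟨⟨0, hn⟩⟩
  let μ : Measure (EuclideanSpace ℝ (Fin n)) := volume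
  let h : (EuclideanSpace ℝ (Fin n)) → 𝕜 := fun w => φ ‖w‖ • Ω (Function.update y j w)
  let H : sphere (0 : (EuclideanSpace ℝ (Fin n))) 1 × Ioi (0 : ℝ) → 𝕜 := fun p => h ((p.2 : ℝ) • (p.1 : (EuclideanSpace ℝ (Fin n))))
  have hpolar : ∫ w, h w ∂μ =
      ∫ p, H p ∂(μ.toSphere.prod (.volumeIoiPow (Module.finrank ℝ (EuclideanSpace ℝ (Fin n)) - 1))) := by
    calc ∫ w, h w ∂μ = ∫ x : ({(0)}ᶜ : Set (EuclideanSpace ℝ (Fin n))), h x.1 ∂(μ.comap (↑)) := by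
          rw [integral_subtype_comap (measurableSet_singleton _).compl fun x ↦ h x,
            restrict_compl_singleton]
      _ = _ := by
          rw [← μ.measurePreserving_homeomorphUnitSphereProd.integral_comp
            (Homeomorph.measurableEmbedding _) H]
          refine integral_congr_ae (.of_forall fun x => ?_)
          have hx : (x : (EuclideanSpace ℝ (Fin n))) ≠ 0 := x.2
          simp only [H]
          congr 1
          rw [homeomorphUnitSphereProd_apply_snd_coe, homeomorphUnitSphereProd_apply_fst_coe,
            smul_inv_smul₀ (norm_ne_zero_iff.2 hx)]
  change ∫ w, h w ∂μ = 0
  rw [hpolar]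
  -- No integrability is needed: otherwise the Bochner integral is `0` by convention.
  by_cases hi : Integrable H (μ.toSphere.prod (.volumeIoiPow (Module.finrank ℝ (EuclideanSpace ℝ (Fin n)) - 1)))
  · rw [integral_prod_symm _ hi]
    refine integral_eq_zero_of_ae (.of_forall fun s => ?_)
    have hs : (0 : ℝ) < s := s.2
    have e : ∀ θ : sphere (0 : (EuclideanSpace ℝ (Fin n))) 1, H (θ, s) =
        φ s • Ω (Function.update ((s : ℝ)⁻¹ • y) j (θ : (EuclideanSpace ℝ (Fin n)))) := by
      intro θ
      have h1 : ‖(θ : (EuclideanSpace ℝ (Fin n)))‖ = 1 := by simp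
      simp only [H, h]
      rw [norm_smul, h1, mul_one, Real.norm_of_nonneg hs.le, ← hhom (s : ℝ)⁻¹ _ (inv_pos.2 hs),
        ← Function.update_smul, inv_smul_smul₀ hs.ne']
    simp_rw [e]
    rw [integral_smul, hvan j, smul_zero]
    rfl
  · exact integral_undef hi

/-- With the other variables fixed, the cutoff and `|u|` depend on the `j`-th variable only through
its norm, so the kernel is `Ω` times a radial factor. -/
theorem integral_truncatedKernel_update_eq_zero (hn : 1 ≤ n)
    {Ω : (Fin m → EuclideanSpace ℝ (Fin n)) → 𝕜}
    (hhom : IsHomogeneousZero Ω) (hvan : HasVanishingSphereIntegrals Ω) (j : Fin m)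
    (y : Fin m → EuclideanSpace ℝ (Fin n)) {t : ℝ} (ht : 0 ≤ t) :
    ∫ w : EuclideanSpace ℝ (Fin n), truncatedKernel Ω t (Function.update y j w) = 0 := by
  classical
  rw [← integral_radial_smul_eq_zero hn hhom hvan j y fun ρ =>
    if ρ ≤ t ∧ ∀ i ≠ j, ‖y i‖ ≤ t then
      (t ^ m)⁻¹ * ((ρ + ∑ i ∈ Finset.univ.erase j, ‖y i‖) ^ (m * (n - 1)))⁻¹ else 0]
  congr 1
  ext w
  have h1 : ‖Function.update y j w‖ ≤ t ↔ ‖w‖ ≤ t ∧ ∀ i ≠ j, ‖y i‖ ≤ t := by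
    rw [pi_norm_le_iff_of_nonneg ht, Function.forall_update_iff y fun _ z => ‖z‖ ≤ t]
  have h2 : sumNorm (Function.update y j w) = ‖w‖ + ∑ i ∈ Finset.univ.erase j, ‖y i‖ := by
    rw [sumNorm, ← Finset.add_sum_erase _ _ (Finset.mem_univ j), Function.update_self]
    congr 1
    refine Finset.sum_congr rfl fun i hi => ?_
    rw [Function.update_of_ne (Finset.ne_of_mem_erase hi)]
  rw [truncatedKernel, h2]
  by_cases h : ‖w‖ ≤ t ∧ ∀ i ≠ j, ‖y i‖ ≤ t
  · rw [if_pos (h1.2 h), if_pos h, smul_smul]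
  · rw [if_neg (fun h' => h (h1.1 h')), if_neg h, zero_smul]

/-- Integrate first in the `j`-th variable, in which the product of the `g i` is constant. -/
theorem integral_truncatedKernel_mul_prod_eq_zero (hn : 1 ≤ n)
    {Ω : (Fin m → EuclideanSpace ℝ (Fin n)) → 𝕜}
    (hhom : IsHomogeneousZero Ω) (hvan : HasVanishingSphereIntegrals Ω)
    (g : Fin m → EuclideanSpace ℝ (Fin n) → 𝕜) (j : Fin m) {a : 𝕜} (hj : ∀ z, g j z = a)
    {t : ℝ} (ht : 0 ≤ t) :
    ∫ y : Fin m → EuclideanSpace ℝ (Fin n), truncatedKernel Ω t y * ∏ i, g i (y i) = 0 := by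
  obtain ⟨k, rfl⟩ : ∃ k, m = k + 1 := ⟨m - 1, by have := j.pos; omega⟩
  have hmp := (volume_preserving_piFinSuccAbove
    (fun _ : Fin (k + 1) => EuclideanSpace ℝ (Fin n)) j).symm
  rw [← hmp.integral_comp' (g := fun y : Fin (k + 1) → EuclideanSpace ℝ (Fin n) =>
    truncatedKernel Ω t y * ∏ i, g i (y i))]
  by_cases hi : Integrable (fun p => (fun y : Fin (k + 1) → EuclideanSpace ℝ (Fin n) =>
      truncatedKernel Ω t y * ∏ i, g i (y i)) ((MeasurableEquiv.piFinSuccAbove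
        (fun _ : Fin (k + 1) => EuclideanSpace ℝ (Fin n)) j).symm p))
      ((volume : Measure (EuclideanSpace ℝ (Fin n))).prod volume)
  · refine (integral_prod_symm _ hi).trans (integral_eq_zero_of_ae (.of_forall fun v => ?_))
    have e : ∀ w : EuclideanSpace ℝ (Fin n),
        (MeasurableEquiv.piFinSuccAbove (fun _ : Fin (k + 1) => EuclideanSpace ℝ (Fin n)) j).symm
          (w, v) = Function.update (j.insertNth 0 v) j w := by
      intro w
      rw [Fin.update_insertNth]
      rfl
    simp only [e]
    have e2 : ∀ w : EuclideanSpace ℝ (Fin n),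
        ∏ i, g i (Function.update
          (j.insertNth (α := fun _ => EuclideanSpace ℝ (Fin n)) 0 v) j w i) =
          a * ∏ i ∈ Finset.univ.erase j, g i (j.insertNth
            (α := fun _ => EuclideanSpace ℝ (Fin n)) 0 v i) := by
      intro w
      rw [← Finset.mul_prod_erase _ _ (Finset.mem_univ j), hj]
      congr 1
      refine Finset.prod_congr rfl fun i hi => ?_
      rw [Function.update_of_ne (Finset.ne_of_mem_erase hi)]
    simp_rw [e2]
    rw [integral_mul_const, integral_truncatedKernel_update_eq_zero hn hhom hvan j _ ht, zero_mul]
    rfl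
  · exact integral_undef hi

/-- Subtracting constants from the arguments does not change `F_t`. -/
theorem marcinkiewiczF_sub_const (hn : 1 ≤ n) {Ω : (Fin m → EuclideanSpace ℝ (Fin n)) → 𝕜}
    (hhom : IsHomogeneousZero Ω) (hvan : HasVanishingSphereIntegrals Ω)
    (hΩ : Measurable Ω) {A : ℝ} (hA : ∀ u, ‖Ω u‖ ≤ A)
    {f : Fin m → EuclideanSpace ℝ (Fin n) → 𝕜} (hf : ∀ i, StronglyMeasurable (f i))
    (hr : ∀ i, RieszIntegrable (f i)) (a : Fin m → 𝕜) {t : ℝ} (ht : 0 < t)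
    (x : EuclideanSpace ℝ (Fin n)) :
    marcinkiewiczF Ω (fun i z => f i z - a i) t x = marcinkiewiczF Ω f t x := by
  classical
  -- Constants are subtracted one index at a time; two consecutive products differ by a product
  -- whose new factor is the constant `a j`.
  suffices H : ∀ s : Finset (Fin m),
      marcinkiewiczF Ω (fun i z => if i ∈ s then f i z - a i else f i z) t x =
        marcinkiewiczF Ω f t x by
    simpa using H Finset.univ
  intro s
  induction s using Finset.induction_on with
  | empty => simp
  | insert j s hjs ih =>
    rw [← ih, ← sub_eq_zero, ← neg_eq_zero, neg_sub]
    set g : Fin m → EuclideanSpace ℝ (Fin n) → 𝕜 :=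
      fun i z => if i ∈ s then f i z - a i else f i z with hg
    set g' : Fin m → EuclideanSpace ℝ (Fin n) → 𝕜 :=
      fun i z => if i ∈ insert j s then f i z - a i else f i z with hg'
    have hmeas : ∀ (s : Finset (Fin m)) i,
        StronglyMeasurable fun z => if i ∈ s then f i z - a i else f i z := by
      intro s i
      by_cases hi : i ∈ s
      · simp only [hi, if_true]; exact (hf i).sub stronglyMeasurable_const
      · simpa only [hi, if_false] using hf i
    have hriesz : ∀ (s : Finset (Fin m)) i,
        RieszIntegrable fun z => if i ∈ s then f i z - a i else f i z := by
      intro s i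
      by_cases hi : i ∈ s
      · simpa only [hi, if_true] using (hr i).sub_const hn (a i)
      · simpa only [hi, if_false] using hr i
    rw [marcinkiewiczF_eq' Ω g ht.le, marcinkiewiczF_eq' Ω g' ht.le,
      ← integral_sub (integrable_truncatedKernel_mul_prod hΩ hA (hmeas s) (hriesz s) ht x)
        (integrable_truncatedKernel_mul_prod hΩ hA (hmeas _) (hriesz _) ht x)]
    set e : Fin m → EuclideanSpace ℝ (Fin n) → 𝕜 := Function.update g j fun _ => a j with he
    have hprod : ∀ z : Fin m → EuclideanSpace ℝ (Fin n),
        ∏ i, g i (z i) - ∏ i, g' i (z i) = ∏ i, e i (z i) := by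
      intro z
      simp only [← Finset.mul_prod_erase _ _ (Finset.mem_univ j)]
      have h1 : ∏ i ∈ Finset.univ.erase j, g' i (z i) = ∏ i ∈ Finset.univ.erase j, g i (z i) := by
        refine Finset.prod_congr rfl fun i hi => ?_
        simp [hg, hg', Finset.mem_insert, Finset.ne_of_mem_erase hi]
      have h2 : ∏ i ∈ Finset.univ.erase j, e i (z i) = ∏ i ∈ Finset.univ.erase j, g i (z i) := by
        refine Finset.prod_congr rfl fun i hi => ?_
        rw [he, Function.update_of_ne (Finset.ne_of_mem_erase hi)]
      have h3 : g j (z j) = f j (z j) := by simp [hg, hjs]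
      have h4 : g' j (z j) = f j (z j) - a j := by simp [hg']
      have h5 : e j (z j) = a j := by simp [he]
      rw [h1, h2, h3, h4, h5]
      ring
    refine (integral_congr_ae (.of_forall fun z =>
      (mul_sub _ _ _).symm.trans (congrArg _ (hprod z)))).trans ?_
    rw [← marcinkiewiczF_eq' Ω e ht.le, marcinkiewiczF_eq Ω e ht.le]
    exact integral_truncatedKernel_mul_prod_eq_zero hn hhom hvan (fun i w => e i (x - w)) j
      (a := a j) (fun z => by rw [he, Function.update_self]) ht.le

end Cancellation

/-! ### Near and far parts -/

section Decomposition

variable {n m : ℕ} {𝕜 : Type*} [RCLike 𝕜]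

/-- The integral of the truncated kernel against `∏ g_i` over a set `S`. -/
noncomputable def truncatedIntegral (Ω : (Fin m → EuclideanSpace ℝ (Fin n)) → 𝕜)
    (g : Fin m → EuclideanSpace ℝ (Fin n) → 𝕜) (S : Set (Fin m → EuclideanSpace ℝ (Fin n)))
    (x : EuclideanSpace ℝ (Fin n)) (t : ℝ) : 𝕜 :=
  ∫ z in S, truncatedKernel Ω t (fun i => x - z i) * ∏ i, g i (z i)

theorem stronglyMeasurable_truncatedKernel_mul_prod_right
    {Ω : (Fin m → EuclideanSpace ℝ (Fin n)) → 𝕜} (hΩ : Measurable Ω)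
    {g : Fin m → EuclideanSpace ℝ (Fin n) → 𝕜} (hg : ∀ i, StronglyMeasurable (g i))
    (x : EuclideanSpace ℝ (Fin n)) :
    StronglyMeasurable fun p : ℝ × (Fin m → EuclideanSpace ℝ (Fin n)) =>
      truncatedKernel Ω p.1 (fun i => x - p.2 i) * ∏ i, g i (p.2 i) := by
  have h : Measurable fun p : ℝ × (Fin m → EuclideanSpace ℝ (Fin n)) => ((p.1, x), p.2) :=
    (measurable_fst.prodMk measurable_const).prodMk measurable_snd
  have h2 := (stronglyMeasurable_truncatedKernel_mul_prod hΩ hg).comp_measurable h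
  exact h2

theorem stronglyMeasurable_truncatedIntegral {Ω : (Fin m → EuclideanSpace ℝ (Fin n)) → 𝕜}
    (hΩ : Measurable Ω) {g : Fin m → EuclideanSpace ℝ (Fin n) → 𝕜}
    (hg : ∀ i, StronglyMeasurable (g i)) (S : Set (Fin m → EuclideanSpace ℝ (Fin n))) :
    StronglyMeasurable fun p : ℝ × EuclideanSpace ℝ (Fin n) =>
      truncatedIntegral Ω g S p.2 p.1 :=
  (stronglyMeasurable_truncatedKernel_mul_prod hΩ hg).integral_prod_right'

theorem aestronglyMeasurable_truncatedIntegral {Ω : (Fin m → EuclideanSpace ℝ (Fin n)) → 𝕜}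
    (hΩ : Measurable Ω) {g : Fin m → EuclideanSpace ℝ (Fin n) → 𝕜}
    (hg : ∀ i, StronglyMeasurable (g i)) (S : Set (Fin m → EuclideanSpace ℝ (Fin n)))
    (x : EuclideanSpace ℝ (Fin n)) :
    AEStronglyMeasurable (truncatedIntegral Ω g S x) logMeasure :=
  ((stronglyMeasurable_truncatedIntegral hΩ hg S).comp_measurable
    (measurable_prodMk_right (y := x))).aestronglyMeasurable

theorem marcinkiewiczF_eq_truncatedIntegral (Ω : (Fin m → EuclideanSpace ℝ (Fin n)) → 𝕜)
    (f : Fin m → EuclideanSpace ℝ (Fin n) → 𝕜) {t : ℝ} (ht : 0 ≤ t)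
    (x : EuclideanSpace ℝ (Fin n)) :
    marcinkiewiczF Ω f t x = truncatedIntegral Ω f univ x t := by
  rw [marcinkiewiczF_eq' Ω f ht, truncatedIntegral, Measure.restrict_univ]

theorem marcinkiewicz_eq_eLpNorm_truncatedIntegral (Ω : (Fin m → EuclideanSpace ℝ (Fin n)) → 𝕜)
    (f : Fin m → EuclideanSpace ℝ (Fin n) → 𝕜) (x : EuclideanSpace ℝ (Fin n)) :
    marcinkiewicz Ω f x = eLpNorm (truncatedIntegral Ω f univ x) 2 logMeasure := by
  rw [marcinkiewicz_eq_eLpNorm]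
  refine eLpNorm_congr_ae ?_
  filter_upwards [ae_logMeasure_pos] with t ht
  exact marcinkiewiczF_eq_truncatedIntegral Ω f ht.le x

theorem measurable_marcinkiewicz {Ω : (Fin m → EuclideanSpace ℝ (Fin n)) → 𝕜}
    (hΩ : Measurable Ω) {f : Fin m → EuclideanSpace ℝ (Fin n) → 𝕜}
    (hf : ∀ i, StronglyMeasurable (f i)) : Measurable (marcinkiewicz Ω f) := by
  have e : marcinkiewicz Ω f = fun x => (∫⁻ t in Ioi 0,
      ‖truncatedIntegral Ω f univ x t‖ₑ ^ 2 / ENNReal.ofReal t) ^ (1 / 2 : ℝ) := by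
    ext x
    rw [marcinkiewicz_eq_eLpNorm_truncatedIntegral, eLpNorm_two_logMeasure]
  rw [e]
  refine Measurable.pow_const ?_ _
  exact Measurable.lintegral_prod_left' (f := fun p : ℝ × EuclideanSpace ℝ (Fin n) =>
    ‖truncatedIntegral Ω f univ p.2 p.1‖ₑ ^ 2 / ENNReal.ofReal p.1)
    (((stronglyMeasurable_truncatedIntegral hΩ hf univ).enorm.pow_const 2).div (by fun_prop))

theorem truncatedIntegral_indicator (Ω : (Fin m → EuclideanSpace ℝ (Fin n)) → 𝕜)
    (g : Fin m → EuclideanSpace ℝ (Fin n) → 𝕜) (c x : EuclideanSpace ℝ (Fin n)) {R : ℝ}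
    (hR : 0 ≤ R) (t : ℝ) :
    truncatedIntegral Ω (fun i => (closedBall c R).indicator (g i)) univ x t =
      truncatedIntegral Ω g (closedBall (fun _ => c) R) x t := by
  rw [truncatedIntegral, truncatedIntegral, Measure.restrict_univ,
    ← integral_indicator measurableSet_closedBall]
  congr 1
  ext z
  rw [closedBall_pi _ hR]
  by_cases hz : z ∈ univ.pi fun _ : Fin m => closedBall c R
  · rw [indicator_of_mem hz]
    congr 1
    exact Finset.prod_congr rfl fun i _ => indicator_of_mem (hz i (mem_univ i)) _
  · rw [indicator_of_notMem hz]
    simp only [mem_univ_pi, not_forall] at hz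
    obtain ⟨i, hi⟩ := hz
    rw [Finset.prod_eq_zero (Finset.mem_univ i) (indicator_of_notMem hi _), mul_zero]

/-- The part of `f i` near the ball of centre `c` and radius `r`, normalised by its average. -/
noncomputable def nearPart (f : Fin m → EuclideanSpace ℝ (Fin n) → 𝕜)
    (c : EuclideanSpace ℝ (Fin n)) (r : ℝ) (i : Fin m) : EuclideanSpace ℝ (Fin n) → 𝕜 :=
  (closedBall c (8 * r)).indicator fun z => f i z - ballAverage (f i) c (8 * r)

/-- The `L²(dt/t)` norm of the contribution away from the ball of centre `c` and radius `8 r`. -/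
noncomputable def farSquare (Ω : (Fin m → EuclideanSpace ℝ (Fin n)) → 𝕜)
    (f : Fin m → EuclideanSpace ℝ (Fin n) → 𝕜) (c : EuclideanSpace ℝ (Fin n)) (r : ℝ)
    (x : EuclideanSpace ℝ (Fin n)) : ℝ≥0∞ :=
  eLpNorm (truncatedIntegral Ω (fun i z => f i z - ballAverage (f i) c (8 * r))
    (closedBall (fun _ => c) (8 * r))ᶜ x) 2 logMeasure

theorem stronglyMeasurable_nearPart {f : Fin m → EuclideanSpace ℝ (Fin n) → 𝕜}
    (hf : ∀ i, StronglyMeasurable (f i)) (c : EuclideanSpace ℝ (Fin n)) (r : ℝ) (i : Fin m) :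
    StronglyMeasurable (nearPart f c r i) :=
  ((hf i).sub stronglyMeasurable_const).indicator measurableSet_closedBall

theorem truncatedIntegral_eq_near_add_far (hn : 1 ≤ n)
    {Ω : (Fin m → EuclideanSpace ℝ (Fin n)) → 𝕜}
    (hhom : IsHomogeneousZero Ω) (hvan : HasVanishingSphereIntegrals Ω)
    (hΩ : Measurable Ω) {A : ℝ} (hA : ∀ u, ‖Ω u‖ ≤ A)
    {f : Fin m → EuclideanSpace ℝ (Fin n) → 𝕜} (hf : ∀ i, StronglyMeasurable (f i))
    (hr : ∀ i, RieszIntegrable (f i)) (c x : EuclideanSpace ℝ (Fin n)) {r : ℝ} (h0 : 0 < r)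
    {t : ℝ} (ht : 0 < t) :
    truncatedIntegral Ω f univ x t = truncatedIntegral Ω (nearPart f c r) univ x t +
      truncatedIntegral Ω (fun i z => f i z - ballAverage (f i) c (8 * r))
        (closedBall (fun _ => c) (8 * r))ᶜ x t := by
  rw [← marcinkiewiczF_eq_truncatedIntegral Ω f ht.le, ← marcinkiewiczF_sub_const hn hhom hvan hΩ
    hA hf hr (fun i => ballAverage (f i) c (8 * r)) ht, marcinkiewiczF_eq' _ _ ht.le]
  unfold nearPart
  rw [truncatedIntegral_indicator Ω _ c x (by positivity) t, truncatedIntegral, truncatedIntegral,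
    integral_add_compl measurableSet_closedBall]
  exact integrable_truncatedKernel_mul_prod hΩ hA (fun i => (hf i).sub stronglyMeasurable_const)
    (fun i => (hr i).sub_const hn _) ht x

section

variable (hn : 1 ≤ n) {Ω : (Fin m → EuclideanSpace ℝ (Fin n)) → 𝕜}
    (hhom : IsHomogeneousZero Ω) (hvan : HasVanishingSphereIntegrals Ω)
    (hΩ : Measurable Ω) {A : ℝ} (hA : ∀ u, ‖Ω u‖ ≤ A)
    {f : Fin m → EuclideanSpace ℝ (Fin n) → 𝕜} (hf : ∀ i, StronglyMeasurable (f i))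
    (hr : ∀ i, RieszIntegrable (f i)) (c x : EuclideanSpace ℝ (Fin n)) {r : ℝ} (h0 : 0 < r)
include hn hhom hvan hΩ hA hf hr h0

theorem marcinkiewicz_le_near_add_far :
    marcinkiewicz Ω f x ≤ marcinkiewicz Ω (nearPart f c r) x + farSquare Ω f c r x := by
  rw [marcinkiewicz_eq_eLpNorm_truncatedIntegral, marcinkiewicz_eq_eLpNorm_truncatedIntegral,
    farSquare]
  refine le_trans (eLpNorm_congr_ae ?_).le (eLpNorm_add_le
    (aestronglyMeasurable_truncatedIntegral hΩ (stronglyMeasurable_nearPart hf c r) _ x)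
    (aestronglyMeasurable_truncatedIntegral hΩ
      (fun i => (hf i).sub stronglyMeasurable_const) _ x) (by norm_num))
  filter_upwards [ae_logMeasure_pos] with t ht
  exact truncatedIntegral_eq_near_add_far hn hhom hvan hΩ hA hf hr c x h0 ht

theorem farSquare_le_add_near :
    farSquare Ω f c r x ≤ marcinkiewicz Ω f x + marcinkiewicz Ω (nearPart f c r) x := by
  rw [marcinkiewicz_eq_eLpNorm_truncatedIntegral, marcinkiewicz_eq_eLpNorm_truncatedIntegral,
    farSquare]
  refine le_trans (eLpNorm_congr_ae ?_).le (eLpNorm_sub_le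
    (aestronglyMeasurable_truncatedIntegral hΩ hf univ x)
    (aestronglyMeasurable_truncatedIntegral hΩ (stronglyMeasurable_nearPart hf c r) univ x)
    (by norm_num))
  filter_upwards [ae_logMeasure_pos] with t ht
  rw [Pi.sub_apply, truncatedIntegral_eq_near_add_far hn hhom hvan hΩ hA hf hr c x h0 ht,
    add_sub_cancel_left]

/-- The boundedness hypothesis gives only almost everywhere finiteness, so the centre needs its own
argument. For `t ≤ 8 r` the kernel at `c` does not reach the far region, and the near part equals
`F_t(f)(c)`. For `t > 8 r` the near part is at most a constant times `t^{-m}`, which is square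
integrable for `dt/t` at infinity. -/
theorem marcinkiewicz_nearPart_center_lt_top (hm : 1 ≤ m) (hfin : marcinkiewicz Ω f c < ∞) :
    marcinkiewicz Ω (nearPart f c r) c < ∞ := by
  have hR : 0 < 8 * r := by positivity
  set g : Fin m → EuclideanSpace ℝ (Fin n) → 𝕜 :=
    fun i z => f i z - ballAverage (f i) c (8 * r) with hg
  have hrg : ∀ i, RieszIntegrable (g i) := fun i => (hr i).sub_const hn _
  set M : ℝ≥0∞ := ENNReal.ofReal A *
    ∏ i, ∫⁻ z in closedBall c (8 * r), (‖c - z‖ₑ ^ (n - 1))⁻¹ * ‖g i z‖ₑ with hM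
  have hMt : M ≠ ∞ := (ENNReal.mul_lt_top (by finiteness)
    (ENNReal.prod_lt_top fun i _ => hrg i c (8 * r))).ne
  set h : ℝ → ℝ := (Ici (8 * r)).indicator fun t => (t ^ m)⁻¹ with hh
  have hhm : Measurable h := Measurable.indicator (by fun_prop) measurableSet_Ici
  have hsmall : ∀ t, 0 < t → t ≤ 8 * r →
      truncatedIntegral Ω g (closedBall (fun _ => c) (8 * r))ᶜ c t = 0 := by
    intro t ht htr
    refine setIntegral_eq_zero_of_forall_eq_zero fun z hz => ?_
    have : ¬ ‖fun i => c - z i‖ ≤ t := by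
      rw [mem_compl_iff, mem_closedBall_iff_norm', Pi.sub_def] at hz
      exact fun h' => hz (h'.trans htr)
    rw [truncatedKernel, if_neg this, zero_mul]
  have hpt : ∀ t, 0 < t → ‖truncatedIntegral Ω (nearPart f c r) univ c t‖ₑ ≤
      ‖‖truncatedIntegral Ω f univ c t‖ + M.toReal * h t‖ₑ := by
    intro t ht
    have hh0 : 0 ≤ h t := indicator_nonneg (fun s hs => by
      have : 0 < s := hR.trans_le hs
      positivity) _
    rw [Real.enorm_of_nonneg (by positivity), ENNReal.ofReal_add (by positivity) (by positivity),
      ofReal_norm]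
    by_cases htr : t ≤ 8 * r
    · rw [truncatedIntegral_eq_near_add_far hn hhom hvan hΩ hA hf hr c c h0 ht, hsmall t ht htr,
        add_zero]
      exact le_self_add
    · refine le_add_left ?_
      rw [ENNReal.ofReal_mul (by positivity), ENNReal.ofReal_toReal hMt, hh,
        indicator_of_mem (show t ∈ Ici (8 * r) from (not_le.1 htr).le)]
      refine (enorm_integral_le_lintegral_enorm _).trans ?_
      rw [Measure.restrict_univ]
      refine (lintegral_truncatedKernel_mul_prod_le hA (stronglyMeasurable_nearPart hf c r)
        ht c).trans ?_
      rw [mul_assoc, mul_comm, hM]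
      refine mul_le_mul_left (mul_le_mul_right (Finset.prod_le_prod' fun i _ => ?_) _) _
      calc ∫⁻ z in closedBall c t, (‖c - z‖ₑ ^ (n - 1))⁻¹ * ‖nearPart f c r i z‖ₑ
          ≤ ∫⁻ z, (closedBall c (8 * r)).indicator
              (fun z => (‖c - z‖ₑ ^ (n - 1))⁻¹ * ‖g i z‖ₑ) z := by
            refine (setLIntegral_le_lintegral _ _).trans (lintegral_mono fun z => ?_)
            rw [nearPart]
            by_cases hz : z ∈ closedBall c (8 * r)
            · rw [indicator_of_mem hz, indicator_of_mem hz]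
            · rw [indicator_of_notMem hz]; simp
        _ = _ := lintegral_indicator measurableSet_closedBall _
  rw [marcinkiewicz_eq_eLpNorm_truncatedIntegral] at hfin ⊢
  have hmeas := aestronglyMeasurable_truncatedIntegral hΩ hf univ c
  calc _ ≤ eLpNorm ((fun t => ‖truncatedIntegral Ω f univ c t‖) + M.toReal • h) 2 logMeasure := by
        refine eLpNorm_mono_enorm_ae ?_
        filter_upwards [ae_logMeasure_pos] with t ht
        exact hpt t ht
    _ ≤ eLpNorm (truncatedIntegral Ω f univ c) 2 logMeasure +
          ‖M.toReal‖ₑ * ENNReal.ofReal ((8 * r) ^ m)⁻¹ := by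
        refine (eLpNorm_add_le hmeas.norm (hhm.const_smul _).aestronglyMeasurable
          (by norm_num)).trans (add_le_add (eLpNorm_norm _).le ?_)
        rw [eLpNorm_const_smul]
        gcongr
        exact eLpNorm_indicator_Ici_inv_pow_le hm hR
    _ < ∞ := ENNReal.add_lt_top.2 ⟨hfin, by finiteness⟩

end

/-- The far part oscillates by at most a multiple of `∏ ‖f_i‖_{BMO}` over the ball. -/
theorem farSquare_le_add {Ω : (Fin m → EuclideanSpace ℝ (Fin n)) → 𝕜} (hn : 1 ≤ n) (hm : 1 ≤ m)
    (hΩ : Measurable Ω) {A : ℝ} (hA : ∀ u, ‖Ω u‖ ≤ A) {K β : ℝ} (hK : 0 ≤ K) (hβ0 : 0 < β)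
    (hβ : β ≤ 1 / 2) (hreg : TruncatedKernelRegular Ω K β)
    {f : Fin m → EuclideanSpace ℝ (Fin n) → 𝕜} (hf : ∀ i, StronglyMeasurable (f i))
    (hl : ∀ i, LocallyIntegrable (f i) volume) {b : Fin m → ℝ≥0} (hb : ∀ i, bmoNorm (f i) ≤ b i)
    {c x x' : EuclideanSpace ℝ (Fin n)} {r : ℝ} (h0 : 0 < r) (hx : x ∈ closedBall c r)
    (hx' : x' ∈ closedBall c r) :
    farSquare Ω f c r x ≤ farSquare Ω f c r x' +
      ENNReal.ofReal (3 * 2 ^ m * K) * farConst n m β * ∏ i, (b i : ℝ≥0∞) := by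
  set g : Fin m → EuclideanSpace ℝ (Fin n) → 𝕜 :=
    fun i z => f i z - ballAverage (f i) c (8 * r) with hg
  have hgm : ∀ i, StronglyMeasurable (g i) := fun i => (hf i).sub stronglyMeasurable_const
  have hrg : ∀ i, RieszIntegrable (g i) := fun i =>
    (RieszIntegrable.of_bmoNorm_le hn (hl i) (hb i)).sub_const hn _
  set S : Set (Fin m → EuclideanSpace ℝ (Fin n)) := (closedBall (fun _ => c) (8 * r))ᶜ
  set H : ℝ → (Fin m → EuclideanSpace ℝ (Fin n)) → 𝕜 := fun t z =>
    truncatedKernel Ω t (fun i => x - z i) * ∏ i, g i (z i) -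
      truncatedKernel Ω t (fun i => x' - z i) * ∏ i, g i (z i) with hH
  have hHm : StronglyMeasurable (Function.uncurry H) :=
    (stronglyMeasurable_truncatedKernel_mul_prod_right hΩ hgm x).sub
      (stronglyMeasurable_truncatedKernel_mul_prod_right hΩ hgm x')
  have hdiff : eLpNorm (truncatedIntegral Ω g S x - truncatedIntegral Ω g S x') 2 logMeasure ≤
      ENNReal.ofReal (3 * 2 ^ m * K) * farConst n m β * ∏ i, (b i : ℝ≥0∞) := by
    calc _ = eLpNorm (fun t => ∫ z in S, H t z) 2 logMeasure := by
          refine eLpNorm_congr_ae ?_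
          filter_upwards [ae_logMeasure_pos] with t ht
          rw [Pi.sub_apply, truncatedIntegral, truncatedIntegral, ← integral_sub
            (integrable_truncatedKernel_mul_prod hΩ hA hgm hrg ht x).integrableOn
            (integrable_truncatedKernel_mul_prod hΩ hA hgm hrg ht x').integrableOn]
      _ ≤ ∫⁻ z in S, eLpNorm (fun t => H t z) 2 logMeasure := eLpNorm_two_integral_le hHm
      _ ≤ ∫⁻ z in S, ENNReal.ofReal (3 * 2 ^ m * K) *
            (farWeight n m β r ‖z - fun _ => c‖ * ∏ i, ‖g i (z i)‖ₑ) := by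
          refine setLIntegral_mono' measurableSet_closedBall.compl fun z hz => ?_
          have hD : 8 * r ≤ ‖z - fun _ => c‖ := by
            rw [mem_compl_iff, mem_closedBall_iff_norm, not_le] at hz
            exact hz.le
          -- All `m` coordinates are shifted by the same vector `y - c`, and the norm is the
          -- maximum, so the distance changes by at most `r`.
          have hnorm : ∀ y ∈ closedBall c r,
              |‖fun i => y - z i‖ - ‖z - fun _ => c‖| ≤ r := by
            intro y hy
            rw [norm_sub_rev]
            refine (abs_norm_sub_norm_le _ _).trans ?_
            have e : (fun i => y - z i) - ((fun _ => c) - z) = fun _ : Fin m => y - c := by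
              ext1 i; simp
            rw [e]
            exact (pi_norm_const_le _).trans (mem_closedBall_iff_norm.1 hy)
          have hxx : ∀ i : Fin m, ‖(x - z i) - (x' - z i)‖ ≤ 2 * r := by
            intro i
            rw [sub_sub_sub_cancel_right, ← dist_eq_norm]
            linarith [dist_triangle_right x x' c, mem_closedBall.1 hx, mem_closedBall.1 hx']
          have h3 := hreg.eLpNorm_sub_le hm hn hK hβ h0 hD hxx (hnorm x hx) (hnorm x' hx')
          have e : (fun t => H t z) = (∏ i, g i (z i)) • fun t =>
              truncatedKernel Ω t (fun i => x - z i) - truncatedKernel Ω t (fun i => x' - z i) := by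
            ext t
            simp only [hH, Pi.smul_apply, smul_eq_mul]
            ring
          rw [e, eLpNorm_const_smul, mul_comm]
          refine (mul_le_mul_left h3 _).trans_eq ?_
          rw [mul_assoc (3 * 2 ^ m * K), ENNReal.ofReal_mul (by positivity), mul_assoc]
          congr 2
          simp only [← ofReal_norm, norm_prod]
          rw [ENNReal.ofReal_prod_of_nonneg fun _ _ => norm_nonneg _]
      _ ≤ _ := by
          rw [lintegral_const_mul' _ _ (by finiteness), mul_assoc (ENNReal.ofReal _)]
          exact mul_le_mul_right (lintegral_compl_closedBall_le hβ0 hf hl hb c h0) _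
  calc farSquare Ω f c r x
      = eLpNorm (truncatedIntegral Ω g S x' +
          (truncatedIntegral Ω g S x - truncatedIntegral Ω g S x')) 2 logMeasure := by
        rw [add_sub_cancel]; rfl
    _ ≤ _ := (eLpNorm_add_le (aestronglyMeasurable_truncatedIntegral hΩ hgm S x')
        ((aestronglyMeasurable_truncatedIntegral hΩ hgm S x).sub
          (aestronglyMeasurable_truncatedIntegral hΩ hgm S x')) (by norm_num)).trans
        (add_le_add le_rfl hdiff)

end Decomposition

/-! ### Assembly of the BMO bound -/

section Main

variable {n m : ℕ} {𝕜 : Type*} [RCLike 𝕜]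

/-- The constant in the `L^p` estimate of the near part of a `BMO` function. -/
noncomputable def nearConst (n : ℕ) (p : ℝ) : ℝ≥0∞ :=
  oscillationConst p ^ p⁻¹ * (exceptionalRatio n)⁻¹

theorem nearConst_ne_top (n : ℕ) {p : ℝ} (hp : 0 < p) : nearConst n p ≠ ∞ :=
  ENNReal.mul_ne_top (ENNReal.rpow_ne_top_of_nonneg (inv_nonneg.2 hp.le)
    (oscillationConst_lt_top hp.le).ne) (ENNReal.inv_ne_top.2 (exceptionalRatio_ne_zero n))

/-- John–Nirenberg on the ball of radius `8 r`, whose average is the constant subtracted in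
`nearPart`. -/
theorem eLpNorm_nearPart_le {f : Fin m → EuclideanSpace ℝ (Fin n) → 𝕜} {i : Fin m}
    (hl : LocallyIntegrable (f i) volume) {b : ℝ≥0} (hb0 : 0 < b) (hb : bmoNorm (f i) ≤ b)
    {p : ℝ} (hp : 0 < p) (c : EuclideanSpace ℝ (Fin n)) {r : ℝ} (hr : 0 < r) :
    eLpNorm (nearPart f c r i) (ENNReal.ofReal p) volume ≤
      nearConst n p * b * volume (closedBall c (8 * r)) ^ (1 / p) := by
  have hp0 : ENNReal.ofReal p ≠ 0 := by simpa using hp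
  rw [nearPart, eLpNorm_indicator_eq_eLpNorm_restrict measurableSet_closedBall,
    eLpNorm_eq_lintegral_rpow_enorm_toReal hp0 ENNReal.ofReal_ne_top, ENNReal.toReal_ofReal hp.le]
  calc _ ≤ (oscillationConst p * ((exceptionalRatio n)⁻¹ * b) ^ p *
        volume (closedBall c (8 * r))) ^ (1 / p) := by
        gcongr
        exact lintegral_rpow_sub_ballAverage_le hl hb0 hb hp c (by positivity)
    _ = _ := by
        rw [ENNReal.mul_rpow_of_nonneg _ _ (by positivity),
          ENNReal.mul_rpow_of_nonneg _ _ (by positivity), ← ENNReal.rpow_mul,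
          mul_one_div_cancel hp.ne', ENNReal.rpow_one, nearConst, one_div]
        ring

/-- The `L^{q₀}` bound of `μ` on the near part, given the boundedness hypothesis. -/
theorem eLpNorm_marcinkiewicz_nearPart_le {Ω : (Fin m → EuclideanSpace ℝ (Fin n)) → 𝕜}
    {q : Fin m → ℝ} {q₀ : ℝ} (hq : ∀ i, 1 < q i) (hq0 : 1 / q₀ = ∑ i, 1 / q i) {C : ℝ≥0}
    (hC : ∀ f : Fin m → EuclideanSpace ℝ (Fin n) → 𝕜,
      (∀ i, MemLp (f i) (ENNReal.ofReal (q i)) volume) →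
      eLpNorm (marcinkiewicz Ω f) (ENNReal.ofReal q₀) volume ≤
        C * ∏ i, eLpNorm (f i) (ENNReal.ofReal (q i)) volume)
    {f : Fin m → EuclideanSpace ℝ (Fin n) → 𝕜} (hf : ∀ i, StronglyMeasurable (f i))
    (hl : ∀ i, LocallyIntegrable (f i) volume) {b : Fin m → ℝ≥0} (hb0 : ∀ i, 0 < b i)
    (hb : ∀ i, bmoNorm (f i) ≤ b i) (c : EuclideanSpace ℝ (Fin n)) {r : ℝ} (hr : 0 < r) :
    eLpNorm (marcinkiewicz Ω (nearPart f c r)) (ENNReal.ofReal q₀) volume ≤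
      (C * ∏ i, nearConst n (q i)) * (∏ i, (b i : ℝ≥0∞)) *
        volume (closedBall c (8 * r)) ^ (1 / q₀) := by
  have hq' : ∀ i, 0 < q i := fun i => by linarith [hq i]
  have hle := fun i => eLpNorm_nearPart_le (hl i) (hb0 i) (hb i) (hq' i) c hr
  have hV0 := volume_closedBall_ne_zero c (by positivity : 0 < 8 * r)
  have hVt := volume_closedBall_ne_top c (8 * r)
  refine (hC _ fun i => ⟨(stronglyMeasurable_nearPart hf c r i).aestronglyMeasurable,
    (hle i).trans_lt ?_⟩).trans ?_
  · exact ENNReal.mul_lt_top (ENNReal.mul_lt_top (nearConst_ne_top n (hq' i)).lt_top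
      ENNReal.coe_lt_top) (ENNReal.rpow_lt_top_of_nonneg (by have := hq' i; positivity) hVt)
  · have hsum : ∏ i, volume (closedBall c (8 * r)) ^ (1 / q i) =
        volume (closedBall c (8 * r)) ^ (1 / q₀) := by
      rw [hq0]
      generalize volume (closedBall c (8 * r)) = V at hV0 hVt
      induction (Finset.univ : Finset (Fin m)) using Finset.cons_induction with
      | empty => simp
      | cons i s hi ih => rw [Finset.prod_cons, Finset.sum_cons, ENNReal.rpow_add _ _ hV0 hVt, ih]
    calc _ ≤ C * ∏ i, (nearConst n (q i) * b i * volume (closedBall c (8 * r)) ^ (1 / q i)) := by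
          gcongr with i
          exact hle i
      _ = _ := by
          rw [Finset.prod_mul_distrib, Finset.prod_mul_distrib, hsum]
          ring

/-- Chebyshev's inequality in scaled form, valid for exponents below `1`, where Hölder's inequality
would give no bound for the mean. -/
theorem volume_le_of_eLpNorm_le {X : Type*} [MeasurableSpace X] {μ : Measure X}
    {N : X → ℝ≥0∞} (hN : Measurable N) {p : ℝ} (hp : 0 < p) {κ τ θ V : ℝ≥0∞}
    (h : eLpNorm N (ENNReal.ofReal p) μ ≤ κ * V ^ (1 / p)) (hκ0 : κ ≠ 0) (hκ : κ ≠ ∞)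
    (hθ0 : θ ≠ 0) (hθ : θ ≠ ∞) (hτ : τ = κ * θ) :
    μ {x | τ ≤ N x} ≤ (θ ^ p)⁻¹ * V := by
  have hp0 : ENNReal.ofReal p ≠ 0 := by simpa using hp
  rw [eLpNorm_eq_lintegral_rpow_enorm_toReal hp0 ENNReal.ofReal_ne_top,
    ENNReal.toReal_ofReal hp.le] at h
  have h1 : ∫⁻ x, N x ^ p ∂μ ≤ κ ^ p * V := by
    have h2 := ENNReal.rpow_le_rpow h hp.le
    rw [← ENNReal.rpow_mul, ENNReal.mul_rpow_of_nonneg _ _ hp.le, ← ENNReal.rpow_mul,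
      one_div_mul_cancel hp.ne', ENNReal.rpow_one, ENNReal.rpow_one] at h2
    exact h2
  have h3 := (mul_meas_ge_le_lintegral (μ := μ) (hN.pow_const p) (τ ^ p)).trans h1
  have h4 : {x | τ ^ p ≤ N x ^ p} = {x | τ ≤ N x} := by
    ext x
    exact ENNReal.rpow_le_rpow_iff hp
  have hκp0 : κ ^ p ≠ 0 := by simp [hκ0, hκ, hp]
  have hκp : κ ^ p ≠ ∞ := ENNReal.rpow_ne_top_of_nonneg hp.le hκ
  have hθp0 : θ ^ p ≠ 0 := by simp [hθ0, hθ, hp]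
  have hθp : θ ^ p ≠ ∞ := ENNReal.rpow_ne_top_of_nonneg hp.le hθ
  rw [h4, hτ, ENNReal.mul_rpow_of_nonneg _ _ hp.le, mul_assoc,
    ENNReal.mul_le_mul_iff_right hκp0 hκp] at h3
  rw [hτ]
  calc μ {x | κ * θ ≤ N x} = (θ ^ p)⁻¹ * (θ ^ p * μ {x | κ * θ ≤ N x}) := by
        rw [← mul_assoc, ENNReal.inv_mul_cancel hθp0 hθp, one_mul]
    _ ≤ _ := by gcongr

/-- A function that is locally close to constants off small sets is of bounded mean oscillation. -/
theorem locallyIntegrable_and_bmoNorm_le {g : EuclideanSpace ℝ (Fin n) → ℝ} (hg : Measurable g)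
    {a : EuclideanSpace ℝ (Fin n) → ℝ → ℝ} {l : ℝ} (hl : 0 < l)
    (h : ∀ x r, 0 < r → volume {y ∈ closedBall x r | l < ‖g y - a x r‖} ≤
      exceptionalRatio n * volume (closedBall x r)) :
    LocallyIntegrable g volume ∧
      bmoNorm g ≤ 2 * (oscillationConst 1 * ENNReal.ofReal l) := by
  have hosc : ∀ x r, 0 < r → ∫⁻ y in closedBall x r, ‖g y - a x r‖ₑ ≤
      oscillationConst 1 * ENNReal.ofReal l * volume (closedBall x r) := by
    intro x r hr
    have := lintegral_rpow_sub_le hg.aestronglyMeasurable hl h one_pos x hr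
    simpa only [ENNReal.rpow_one] using this
  have hosct : oscillationConst 1 < ∞ := oscillationConst_lt_top zero_le_one
  have hli : LocallyIntegrable g volume := by
    intro x
    refine ⟨closedBall x 1, closedBall_mem_nhds x one_pos, ?_⟩
    have h1 : IntegrableOn (fun y => g y - a x 1) (closedBall x 1) volume :=
      ⟨(hg.sub_const _).aestronglyMeasurable, (hosc x 1 one_pos).trans_lt
        (ENNReal.mul_lt_top (ENNReal.mul_lt_top hosct ENNReal.ofReal_lt_top)
          (volume_closedBall_ne_top x 1).lt_top)⟩
    have h2 : IntegrableOn (fun _ => a x 1) (closedBall x 1) volume :=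
      integrableOn_const (volume_closedBall_ne_top x 1)
    have h3 := h1.add h2
    exact h3.congr (.of_forall fun y => by simp)
  exact ⟨hli, bmoNorm_le_two_mul hli fun c r hr => ⟨a c r, hosc c r hr⟩⟩

theorem abs_toReal_sub_le {u v w : ℝ≥0∞} (hv : v ≠ ∞) (hw : w ≠ ∞) (h1 : u ≤ v + w)
    (h2 : v ≤ u + w) : |u.toReal - v.toReal| ≤ w.toReal := by
  have hu : u ≠ ∞ := ne_top_of_le_ne_top (by finiteness) h1
  have h1' := ENNReal.toReal_mono (by finiteness) h1
  have h2' := ENNReal.toReal_mono (by finiteness) h2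
  rw [ENNReal.toReal_add (by finiteness) (by finiteness)] at h1' h2'
  rw [abs_le]
  constructor <;> linarith

theorem exists_const_marcinkiewicz_bmo (hn : 1 ≤ n) (hm : 1 ≤ m)
    {Ω : (Fin m → EuclideanSpace ℝ (Fin n)) → 𝕜}
    (hhom : IsHomogeneousZero Ω) (hlip : IsLipschitzKernel Ω)
    (hvan : HasVanishingSphereIntegrals Ω) {q : Fin m → ℝ} {q₀ : ℝ} (hq : ∀ i, 1 < q i)
    (hq0 : 1 / q₀ = ∑ i, 1 / q i) (hbdd : MarcinkiewiczBounded Ω q q₀) :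
    ∃ C : ℝ≥0, 0 < C ∧ ∀ f : Fin m → EuclideanSpace ℝ (Fin n) → 𝕜,
      (∀ i, StronglyMeasurable (f i)) → (∀ i, LocallyIntegrable (f i) volume) →
      ∀ b : Fin m → ℝ≥0, (∀ i, 0 < b i) → (∀ i, bmoNorm (f i) ≤ b i) →
      (∃ x₀ : EuclideanSpace ℝ (Fin n), marcinkiewicz Ω f x₀ < ∞) →
        (∀ᵐ x : EuclideanSpace ℝ (Fin n), marcinkiewicz Ω f x < ∞) ∧
        LocallyIntegrable (fun x => (marcinkiewicz Ω f x).toReal) volume ∧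
        bmoNorm (fun x => (marcinkiewicz Ω f x).toReal) ≤ C * ∏ i, (b i : ℝ≥0∞) := by
  obtain ⟨C₀, hC₀⟩ := hbdd
  obtain ⟨A, hA0, hA⟩ := hlip.exists_bound
  have hΩ := hlip.measurable
  obtain ⟨K, β, hK, hβ0, hβ, hreg⟩ := hlip.exists_truncatedKernelRegular
  have hq' : ∀ i, 0 < q i := fun i => by linarith [hq i]
  have hq0' : 0 < q₀ := by
    have : Nonempty (Fin m) := ⟨⟨0, hm⟩⟩
    rw [← one_div_pos, hq0]
    exact Finset.sum_pos (fun i _ => one_div_pos.2 (hq' i)) Finset.univ_nonempty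
  -- Adding `1` keeps `Γ`, and with it the level `τ`, nonzero.
  set Γ : ℝ≥0∞ := C₀ * ∏ i, nearConst n (q i) + 1 with hΓ
  have hΓt : Γ ≠ ∞ := by
    have : ∏ i, nearConst n (q i) ≠ ∞ :=
      (ENNReal.prod_lt_top fun i _ => (nearConst_ne_top n (hq' i)).lt_top).ne
    finiteness
  have hΓ0 : Γ ≠ 0 := by simp [hΓ]
  have hε0 := exceptionalRatio_ne_zero n
  have hεt := exceptionalRatio_ne_top n
  have hεi0 : (exceptionalRatio n)⁻¹ ≠ 0 := ENNReal.inv_ne_zero.2 hεt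
  have hεit : (exceptionalRatio n)⁻¹ ≠ ∞ := ENNReal.inv_ne_top.2 hε0
  -- Chosen so that Chebyshev at level `Γ P θ`, with the volume of the ball of radius `8 r` on the
  -- right, leaves exactly the admissible proportion of the ball of radius `r`.
  set θ : ℝ≥0∞ := (8 ^ n * (exceptionalRatio n)⁻¹) ^ (1 / q₀) with hθ
  have hθt : θ ≠ ∞ := ENNReal.rpow_ne_top_of_nonneg (by positivity) (by finiteness)
  have hθ0 : θ ≠ 0 := by
    have h8 : (8 : ℝ≥0∞) ^ n * (exceptionalRatio n)⁻¹ ≠ 0 := mul_ne_zero (by simp) hεi0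
    rw [hθ, Ne, ENNReal.rpow_eq_zero_iff]
    rintro (⟨h, -⟩ | ⟨-, h⟩)
    · exact h8 h
    · exact absurd h (not_lt.2 (by positivity))
  have hθp : (θ ^ q₀)⁻¹ * 8 ^ n = exceptionalRatio n := by
    rw [hθ, ← ENNReal.rpow_mul, one_div_mul_cancel hq0'.ne', ENNReal.rpow_one,
      ENNReal.mul_inv (by simp) (by simp), inv_inv, mul_right_comm,
      ENNReal.inv_mul_cancel (by simp) (by simp), one_mul]
  set Λ : ℝ≥0∞ := ENNReal.ofReal (3 * 2 ^ m * K) * farConst n m β with hΛ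
  have hfar := farConst_lt_top n m hβ0
  have hΛt : Λ ≠ ∞ := by finiteness
  have hosct : oscillationConst 1 ≠ ∞ := (oscillationConst_lt_top zero_le_one).ne
  set C : ℝ≥0∞ := 2 * (oscillationConst 1 * (Γ * θ + Λ)) with hC
  have hCt : C ≠ ∞ := by finiteness
  have hC0 : C ≠ 0 := by
    have : oscillationConst 1 ≠ 0 := by simp [oscillationConst]
    simp [hC, this, hΓ0, hθ0]
  refine ⟨C.toNNReal, ENNReal.toNNReal_pos hC0 hCt, ?_⟩
  intro f hf hl b hb0 hb hx₀
  rw [ENNReal.coe_toNNReal hCt]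
  have hr : ∀ i, RieszIntegrable (f i) := fun i => RieszIntegrable.of_bmoNorm_le hn (hl i) (hb i)
  set P : ℝ≥0∞ := ∏ i, (b i : ℝ≥0∞) with hP
  have hPt : P ≠ ∞ := (ENNReal.prod_lt_top fun i _ => ENNReal.coe_lt_top).ne
  have hP0 : P ≠ 0 := Finset.prod_ne_zero_iff.2 fun i _ => by simpa using (hb0 i).ne'
  have hμm := measurable_marcinkiewicz hΩ hf
  have hNm : ∀ c r, Measurable (marcinkiewicz Ω (nearPart f c r)) := fun c r =>
    measurable_marcinkiewicz hΩ (stronglyMeasurable_nearPart hf c r)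
  have hN : ∀ (c : EuclideanSpace ℝ (Fin n)) {r : ℝ}, 0 < r →
      eLpNorm (marcinkiewicz Ω (nearPart f c r)) (ENNReal.ofReal q₀) volume ≤
        Γ * P * volume (closedBall c (8 * r)) ^ (1 / q₀) := by
    intro c r h0
    refine (eLpNorm_marcinkiewicz_nearPart_le hq hq0 hC₀ hf hl hb0 hb c h0).trans ?_
    gcongr
    exact le_self_add
  have hNfin : ∀ (c : EuclideanSpace ℝ (Fin n)) {r : ℝ}, 0 < r →
      ∀ᵐ x, marcinkiewicz Ω (nearPart f c r) x < ∞ := by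
    intro c r h0
    have hq00 : ENNReal.ofReal q₀ ≠ 0 := by simpa using hq0'
    have hVt := volume_closedBall_ne_top c (8 * r)
    have h1 : eLpNorm (marcinkiewicz Ω (nearPart f c r)) (ENNReal.ofReal q₀) volume < ∞ :=
      (hN c h0).trans_lt (ENNReal.mul_lt_top (by finiteness)
        (ENNReal.rpow_lt_top_of_nonneg (by positivity) hVt))
    have h2 := lintegral_rpow_enorm_lt_top_of_eLpNorm_lt_top hq00 ENNReal.ofReal_ne_top h1
    rw [ENNReal.toReal_ofReal hq0'.le] at h2
    filter_upwards [ae_lt_top ((hNm c r).pow_const q₀) h2.ne] with x hx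
    by_contra hc
    rw [not_lt, top_le_iff] at hc
    rw [hc, ENNReal.top_rpow_of_pos hq0'] at hx
    exact hx.false
  have hosc : ∀ {c x x' : EuclideanSpace ℝ (Fin n)} {r : ℝ}, 0 < r → x ∈ closedBall c r →
      x' ∈ closedBall c r → farSquare Ω f c r x ≤ farSquare Ω f c r x' + Λ * P :=
    fun h0 hx hx' => farSquare_le_add hn hm hΩ hA hK hβ0 hβ hreg hf hl hb h0 hx hx'
  obtain ⟨x₀, hx₀⟩ := hx₀
  -- Balls centred at `x₀` exhaust the space; on each, the far part is finite at `x₀` and therefore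
  -- everywhere.
  have hae : ∀ᵐ x : EuclideanSpace ℝ (Fin n), marcinkiewicz Ω f x < ∞ := by
    have h1 : ∀ k : ℕ, ∀ᵐ x : EuclideanSpace ℝ (Fin n), x ∈ closedBall x₀ (k + 1 : ℝ) →
        marcinkiewicz Ω f x < ∞ := by
      intro k
      have h0 : (0 : ℝ) < k + 1 := by positivity
      filter_upwards [hNfin x₀ h0] with x hx hxB
      have h2 : farSquare Ω f x₀ (k + 1) x₀ < ∞ :=
        (farSquare_le_add_near hn hhom hvan hΩ hA hf hr x₀ x₀ h0).trans_lt (ENNReal.add_lt_top.2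
          ⟨hx₀, marcinkiewicz_nearPart_center_lt_top hn hhom hvan hΩ hA hf hr x₀ h0 hm hx₀⟩)
      have h3 := hosc h0 hxB (mem_closedBall_self h0.le)
      refine (marcinkiewicz_le_near_add_far hn hhom hvan hΩ hA hf hr x₀ x h0).trans_lt
        (ENNReal.add_lt_top.2 ⟨hx, h3.trans_lt ?_⟩)
      exact ENNReal.add_lt_top.2 ⟨h2, by finiteness⟩
    filter_upwards [ae_all_iff.2 h1] with x hx
    obtain ⟨k, hk⟩ := exists_nat_ge (dist x x₀)
    exact hx k (mem_closedBall.2 (by linarith))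
  -- For an arbitrary ball `μ(f)` may be infinite at `c`. Finiteness of the far part is carried to
  -- `c` from some point of the ball where both `μ(f)` and `μ` of the near part are finite.
  have hcenter : ∀ (c : EuclideanSpace ℝ (Fin n)) {r : ℝ}, 0 < r → farSquare Ω f c r c ≠ ∞ := by
    intro c r h0
    obtain ⟨x, hxB, hx1, hx2⟩ : ∃ x ∈ closedBall c r, marcinkiewicz Ω f x < ∞ ∧
        marcinkiewicz Ω (nearPart f c r) x < ∞ := by
      by_contra! hc
      have h4 : ∀ᵐ x : EuclideanSpace ℝ (Fin n), x ∉ closedBall c r := by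
        filter_upwards [hae, hNfin c h0] with x h1 h2 h3
        exact absurd h2 (not_lt.2 (hc x h3 h1))
      refine volume_closedBall_ne_zero c h0 ?_
      have h5 := ae_iff.1 h4
      simp only [not_not] at h5
      exact h5
    refine (lt_of_le_of_lt (hosc h0 (mem_closedBall_self h0.le) hxB) ?_).ne
    refine ENNReal.add_lt_top.2 ⟨?_, by finiteness⟩
    exact (farSquare_le_add_near hn hhom hvan hΩ hA hf hr c x h0).trans_lt
      (ENNReal.add_lt_top.2 ⟨hx1, hx2⟩)
  set τ : ℝ≥0∞ := Γ * P * θ with hτ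
  have hτt : τ ≠ ∞ := by finiteness
  have hτ0 : τ ≠ 0 := mul_ne_zero (mul_ne_zero hΓ0 hP0) hθ0
  have hwt : τ + Λ * P ≠ ∞ := by finiteness
  have hl0 : 0 < (τ + Λ * P).toReal := ENNReal.toReal_pos (by simp [hτ0]) hwt
  have hlev : ∀ (c : EuclideanSpace ℝ (Fin n)) (r : ℝ), 0 < r →
      volume {y ∈ closedBall c r | (τ + Λ * P).toReal <
        ‖(marcinkiewicz Ω f y).toReal - (farSquare Ω f c r c).toReal‖} ≤
      exceptionalRatio n * volume (closedBall c r) := by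
    intro c r h0
    -- Where the near part is below `τ`, `μ(f)` is within `τ + Λ P` of the far part at the centre,
    -- by the triangle inequality in both directions.
    calc _ ≤ volume {y | τ ≤ marcinkiewicz Ω (nearPart f c r) y} := by
          refine measure_mono fun y hy => ?_
          by_contra hlt
          have hlt' : marcinkiewicz Ω (nearPart f c r) y ≤ τ := (not_le.1 hlt).le
          refine absurd hy.2 (not_lt.2 ?_)
          rw [Real.norm_eq_abs]
          refine abs_toReal_sub_le (hcenter c h0) hwt ?_ ?_
          · calc _ ≤ _ := marcinkiewicz_le_near_add_far hn hhom hvan hΩ hA hf hr c y h0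
              _ ≤ τ + (farSquare Ω f c r c + Λ * P) :=
                add_le_add hlt' (hosc h0 hy.1 (mem_closedBall_self h0.le))
              _ = _ := by ring
          · calc _ ≤ _ := hosc h0 (mem_closedBall_self h0.le) hy.1
              _ ≤ (marcinkiewicz Ω f y + τ) + Λ * P := by
                gcongr
                exact (farSquare_le_add_near hn hhom hvan hΩ hA hf hr c y h0).trans
                  (by gcongr)
              _ = _ := by ring
      _ ≤ (θ ^ q₀)⁻¹ * volume (closedBall c (8 * r)) :=
          volume_le_of_eLpNorm_le (hNm c r) hq0' (hN c h0) (mul_ne_zero hΓ0 hP0)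
            (by finiteness) hθ0 hθt hτ
      _ = _ := by
          rw [volume_closedBall_scale c c (by norm_num) h0.le, ← mul_assoc, ENNReal.ofReal_ofNat,
            hθp]
  obtain ⟨h1, h2⟩ := locallyIntegrable_and_bmoNorm_le hμm.ennreal_toReal
    (a := fun c r => (farSquare Ω f c r c).toReal) hl0 hlev
  refine ⟨hae, h1, h2.trans_eq ?_⟩
  rw [ENNReal.ofReal_toReal hwt, hC, hτ]
  ring

/-! ### Representatives and the limit to zero seminorms -/

/-- Equality holds at every `x`, since the arguments enter only under an integral; hence the
condition at the single point `x₀` survives a change of representatives. -/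
theorem marcinkiewicz_congr_ae (Ω : (Fin m → EuclideanSpace ℝ (Fin n)) → 𝕜)
    {f g : Fin m → EuclideanSpace ℝ (Fin n) → 𝕜} (h : ∀ i, f i =ᵐ[volume] g i) :
    marcinkiewicz Ω f = marcinkiewicz Ω g := by
  ext x
  rw [marcinkiewicz_eq_eLpNorm_truncatedIntegral, marcinkiewicz_eq_eLpNorm_truncatedIntegral]
  congr 1
  ext t
  rw [truncatedIntegral, truncatedIntegral, Measure.restrict_univ]
  have h1 : ∀ᵐ z : Fin m → EuclideanSpace ℝ (Fin n), ∀ i, f i (z i) = g i (z i) :=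
    ae_all_iff.2 fun i =>
    (Measure.quasiMeasurePreserving_eval
      (fun _ : Fin m => (volume : Measure (EuclideanSpace ℝ (Fin n)))) i).ae
      (p := fun z => f i z = g i z) (h i)
  refine integral_congr_ae ?_
  filter_upwards [h1] with z hz
  simp_rw [hz]

theorem bmoNorm_congr_ae {F : Type*} [NormedAddCommGroup F] [NormedSpace ℝ F]
    {f g : EuclideanSpace ℝ (Fin n) → F} (h : f =ᵐ[volume] g) : bmoNorm f = bmoNorm g := by
  unfold bmoNorm
  congr 1
  ext c
  congr 1
  ext r
  congr 1
  ext _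
  have h1 : f =ᵐ[volume.restrict (closedBall c r)] g := ae_restrict_of_ae h
  rw [average_congr h1]
  refine laverage_congr ?_
  filter_upwards [h1] with x hx
  rw [hx]

/-- The John–Nirenberg step needs strictly positive bounds, while a BMO seminorm can vanish; letting
`δ → 0` covers this case. -/
theorem le_const_mul_prod_of_forall_pos_lt {ι : Type*} [Fintype ι] {M : ℝ≥0∞} {C : ℝ≥0}
    {b : ι → ℝ≥0} (h : ∀ δ : ℝ≥0, 0 < δ → M ≤ C * ∏ i, ((b i + δ : ℝ≥0) : ℝ≥0∞)) :
    M ≤ C * ∏ i, (b i : ℝ≥0∞) := by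
  have hc : Continuous fun δ : ℝ≥0 => ((C * ∏ i, (b i + δ) : ℝ≥0) : ℝ≥0∞) :=
    ENNReal.continuous_coe.comp (by fun_prop)
  have hlim := (hc.tendsto 0).mono_left (nhdsWithin_le_nhds (s := Ioi 0))
  have := ge_of_tendsto hlim (by
    filter_upwards [self_mem_nhdsWithin] with δ hδ
    have := h δ hδ
    push_cast at this ⊢
    exact this)
  simpa using this

end Main

theorem theorem1p1 {𝕜 : Type*} [RCLike 𝕜] (n m : ℕ) (hn : 1 ≤ n) (hm : 1 ≤ m)
    (Ω : (Fin m → EuclideanSpace ℝ (Fin n)) → 𝕜)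
    (hhom : IsHomogeneousZero Ω) (hlip : IsLipschitzKernel Ω)
    (hvan : HasVanishingSphereIntegrals Ω)
    (hbdd : ∃ (q : Fin m → ℝ) (q₀ : ℝ), (∀ i, 1 < q i) ∧ 1 / q₀ = ∑ i, 1 / q i ∧
      MarcinkiewiczBounded Ω q q₀) :
    ∃ C : ℝ≥0, 0 < C ∧ ∀ f : Fin m → EuclideanSpace ℝ (Fin n) → 𝕜,
      (∀ i, MemBMO (f i)) →
      (∃ x₀ : EuclideanSpace ℝ (Fin n), marcinkiewicz Ω f x₀ < ∞) →
        (∀ᵐ x : EuclideanSpace ℝ (Fin n), marcinkiewicz Ω f x < ∞) ∧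
        MemBMO (fun x => (marcinkiewicz Ω f x).toReal) ∧
        bmoNorm (fun x => (marcinkiewicz Ω f x).toReal) ≤ C * ∏ i, bmoNorm (f i) := by
  obtain ⟨q, q₀, hq, hq0, hb⟩ := hbdd
  obtain ⟨C, hC, H⟩ := exists_const_marcinkiewicz_bmo hn hm hhom hlip hvan hq hq0 hb
  refine ⟨C, hC, fun f hf hx₀ => ?_⟩
  have hmeas : ∀ i, AEStronglyMeasurable (f i) volume := fun i => (hf i).1.aestronglyMeasurable
  -- Strongly measurable representatives give the joint measurability used for Tonelli and
  -- Minkowski.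
  set g : Fin m → EuclideanSpace ℝ (Fin n) → 𝕜 := fun i => (hmeas i).mk (f i) with hg
  have hgf : ∀ i, f i =ᵐ[volume] g i := fun i => (hmeas i).ae_eq_mk
  have hgm : ∀ i, StronglyMeasurable (g i) := fun i => (hmeas i).stronglyMeasurable_mk
  have hgl : ∀ i, LocallyIntegrable (g i) volume := fun i => (hf i).1.congr (hgf i)
  rw [marcinkiewicz_congr_ae Ω hgf] at hx₀ ⊢
  have hbg : ∀ i, bmoNorm (f i) = bmoNorm (g i) := fun i => bmoNorm_congr_ae (hgf i)
  set b : Fin m → ℝ≥0 := fun i => (bmoNorm (g i)).toNNReal with hb'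
  have hbc : ∀ i, bmoNorm (g i) = b i := fun i =>
    (ENNReal.coe_toNNReal (by rw [← hbg i]; exact (hf i).2.ne)).symm
  have key : ∀ δ : ℝ≥0, 0 < δ → _ := fun δ hδ =>
    H g hgm hgl (fun i => b i + δ) (fun i => add_pos_of_nonneg_of_pos zero_le hδ)
      (fun i => by rw [hbc i]; exact_mod_cast le_self_add) hx₀
  have hle : bmoNorm (fun x => (marcinkiewicz Ω g x).toReal) ≤ C * ∏ i, (b i : ℝ≥0∞) :=
    le_const_mul_prod_of_forall_pos_lt fun δ hδ => (key δ hδ).2.2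
  -- Finiteness and local integrability do not involve `δ`, so any positive value will do.
  obtain ⟨h1, h2, -⟩ := key 1 one_pos
  refine ⟨h1, ⟨h2, hle.trans_lt ?_⟩, ?_⟩
  · exact ENNReal.mul_lt_top ENNReal.coe_lt_top (ENNReal.prod_lt_top fun i _ => ENNReal.coe_lt_top)
  · simp_rw [hbg, hbc]
    exact hle
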